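/- Let $N\ge 4$. For $d\ge 2$ let $V^2(\mathbb R^d)=\{v=(v_1,v_2)\in\mathbb S^{d-1}\times\mathbb S^{d-1}: v_1^Tv_2=0\}$ be the Stiefel manifold, with the rotationally invariant volume form $d\mathbf v$ which is, up to sign, $\bigwedge_{j\in\{1,2\},\,j<i\le d} v_i^T dv_j$ for any completion of $v_1,v_2$ to an orthonormal basis $v_1,\dots,v_d$ of $\mathbb R^d$. For $a\in\mathbb R$, $b>0$ and $\theta\in(0,\pi/2)$ put $$\Lambda_{a,b,\theta}=\begin{pmatrix} a & b\tan\theta\\ -\frac{b}{\tan\theta} & a\end{pmatrix}.$$ Let $\Omega=\Omega_1\times\Omega_2\times M_{(N-4)\times(N-4)}(\mathbb R)$, where $$\Omega_1=\mathbb R\times(0,\infty)\times(0,\tfrac{\pi}{2})\times V^2(\mathbb R^N)\times M_{(N-2)\times 2}(\mathbb R),\qquad \Omega_2=\mathbb R\times(0,\infty)\times(0,\tfrac{\pi}{2})\times V^2(\mathbb R^{N-2})\times M_{(N-4)\times 2}(\mathbb R).$$ Let $U_1\subset V^2(\mathbb R^N)$ and $U_2\subset V^2(\mathbb R^{N-2})$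 be relatively open, and let $R_1:U_1\to\mathbf O(N)$, $R_2:U_2\to\mathbf O(N-2)$ be smooth maps with $R_1(\mathbf v)\mathbf e_i=v_i$ and $R_2(\mathbf u)\mathbf e_i=u_i$ for $i=1,2$. For $\omega=(a_1,b_1,\theta_1,\mathbf v,W_1,a_2,b_2,\theta_2,\mathbf u,W_2,M^{(2)})\in\Omega$ with $\mathbf v\in U_1$, $\mathbf u\in U_2$ put $$\Phi(\omega)=R_1(\mathbf v)\begin{pmatrix}\Lambda_{a_1,b_1,\theta_1}&W_1^T\\0&M^{(1)}\end{pmatrix}R_1(\mathbf v)^T\in M_{N\times N}(\mathbb R),\qquad M^{(1)}=R_2(\mathbf u)\begin{pmatrix}\Lambda_{a_2,b_2,\theta_2}&W_2^T\\0&M^{(2)}\end{pmatrix}R_2(\mathbf u)^T.$$ Then $\Phi$ is differentiable at every such $\omega$. Its Jacobian $J(\Phi)(\omega)$, that is, the factor by which the differential $d\Phi_\omega$ multiplies volumes, with respect to the volume $da_1\,db_1\,d\theta_1\,d\mathbf v\,dW_1\,da_2\,db_2\,d\theta_2\,d\mathbf u\,dW_2\,dM^{(2)}$ on $\Omega$ and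 Lebesgue measure on $M_{N\times N}(\mathbb R)$, is given, with $\lambda_j=a_j+ib_j$, by $$J(\Phi)=\frac{256\,b_1^2b_2^2\,|\cos 2\theta_1|\,|\cos2\theta_2|}{\sin^2 2\theta_1\,\sin^22\theta_2}\,|\lambda_1-\lambda_2|^2\,|\lambda_1-\overline{\lambda}_2|^2\,\bigl|\det(M^{(2)}-\lambda_1)\bigr|^2\,\bigl|\det(M^{(2)}-\lambda_2)\bigr|^2 .$$ -/

import Mathlib

open scoped Matrix ContDiff

attribute [local instance] Matrix.frobeniusNormedAddCommGroup Matrix.frobeniusNormedSpace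

noncomputable section

/-- The Stiefel manifold `V²(ℝ^ι)`: pairs of orthonormal vectors, stored as the two columns of a matrix. -/
def stiefel (ι : Type) [Fintype ι] [DecidableEq ι] : Set (Matrix ι (Fin 2) ℝ) :=
  {v | vᵀ * v = 1}

/-- The tangent space of the Stiefel manifold at `v`: the `X` with `vᵀ X` skew-symmetric. -/
def stiefelTangent {ι : Type} [Fintype ι] [DecidableEq ι] (v : Matrix ι (Fin 2) ℝ) :
    Submodule ℝ (Matrix ι (Fin 2) ℝ) where
  carrier := {X | vᵀ * X + Xᵀ * v = 0}
  zero_mem' := by simp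
  add_mem' := by
    intro X Y hX hY
    simp only [Set.mem_ofPred_eq, Matrix.transpose_add, Matrix.mul_add, Matrix.add_mul] at *
    rw [add_add_add_comm, hX, hY, add_zero]
  smul_mem' := by
    intro c X hX
    simp only [Set.mem_ofPred_eq, Matrix.transpose_smul, Matrix.mul_smul, Matrix.smul_mul] at *
    rw [← smul_add, hX, smul_zero]

/-- The Euclidean (Frobenius) inner product `tr(Aᵀ B)` on matrices; its volume is Lebesgue measure
in the entries. -/
def frobeniusForm (ι κ : Type) [Fintype ι] [Fintype κ] :
    LinearMap.BilinForm ℝ (Matrix ι κ ℝ) :=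
  LinearMap.mk₂ ℝ (fun A B => (Aᵀ * B).trace)
    (by intros; simp [Matrix.add_mul]) (by intros; simp)
    (by intros; simp [Matrix.mul_add]) (by intros; simp)

/-- The canonical `O(ι)`-invariant metric `tr(Xᵀ Y) - tr((vᵀ X)ᵀ (vᵀ Y)) / 2` of the Stiefel manifold at `v`.
If `v₁, v₂, v₃, …` is an orthonormal basis, it is the sum of the squares of the one-forms
`v_iᵀ dv_j` (`j = 1, 2`, `j < i`), see `stiefelMetric_frame`. Its volume is therefore the rotationally
invariant volume `⋀_{j < i} v_iᵀ dv_j`. -/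
def stiefelMetric {ι : Type} [Fintype ι] [DecidableEq ι] (v : Matrix ι (Fin 2) ℝ) :
    LinearMap.BilinForm ℝ (Matrix ι (Fin 2) ℝ) :=
  LinearMap.mk₂ ℝ (fun X Y => (Xᵀ * Y).trace - (1 / 2) * ((vᵀ * X)ᵀ * (vᵀ * Y)).trace)
    (by intros; simp [Matrix.add_mul, Matrix.mul_add]; ring) (by intros; simp; ring)
    (by intros; simp [Matrix.mul_add]; ring) (by intros; simp; ring)

theorem stiefelMetric_apply {ι : Type} [Fintype ι] [DecidableEq ι] (v X Y : Matrix ι (Fin 2) ℝ) :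
    stiefelMetric v X Y = (Xᵀ * Y).trace - (1 / 2) * ((vᵀ * X)ᵀ * (vᵀ * Y)).trace := rfl

/-- Rotational invariance. -/
theorem stiefelMetric_mul {ι : Type} [Fintype ι] [DecidableEq ι] (Q : Matrix ι ι ℝ)
    (hQ : Q ∈ Matrix.orthogonalGroup ι ℝ) (v X Y : Matrix ι (Fin 2) ℝ) :
    stiefelMetric (Q * v) (Q * X) (Q * Y) = stiefelMetric v X Y := by
  have h : Qᵀ * Q = 1 := by simpa using (Matrix.mem_orthogonalGroup_iff' (A := Q)).1 hQ
  have key : ∀ A B : Matrix ι (Fin 2) ℝ, (Q * A)ᵀ * (Q * B) = Aᵀ * B := by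
    intro A B
    rw [Matrix.transpose_mul, Matrix.mul_assoc, ← Matrix.mul_assoc Qᵀ, h, Matrix.one_mul]
  rw [stiefelMetric_apply, stiefelMetric_apply, key, key, key]

/-- Normalization: for `Q` orthogonal with first two columns `v`, and tangent vectors
`Q (0, -f; f, 0; H)`, the metric is the Euclidean one in the coordinates `f = v₂ᵀ dv₁` and
`H` (the entries `v_iᵀ dv_j`, `i > 2`). -/
theorem stiefelMetric_frame {m : Type} [Fintype m] [DecidableEq m]
    (Q : Matrix (Fin 2 ⊕ m) (Fin 2 ⊕ m) ℝ) (hQ : Q ∈ Matrix.orthogonalGroup (Fin 2 ⊕ m) ℝ)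
    (f f' : ℝ) (H H' : Matrix m (Fin 2) ℝ) :
    stiefelMetric (Q * (Matrix.fromRows 1 0 : Matrix (Fin 2 ⊕ m) (Fin 2) ℝ))
      (Q * (Matrix.fromRows !![0, -f; f, 0] H : Matrix (Fin 2 ⊕ m) (Fin 2) ℝ))
      (Q * (Matrix.fromRows !![0, -f'; f', 0] H' : Matrix (Fin 2 ⊕ m) (Fin 2) ℝ)) = f * f' + (Hᵀ * H').trace := by
  rw [stiefelMetric_mul Q hQ, stiefelMetric_apply]
  simp only [Matrix.transpose_fromRows, Matrix.fromCols_mul_fromRows, Matrix.trace_add]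
  simp [Matrix.trace_fin_two, Matrix.mul_apply, Fin.sum_univ_two]
  ring

/-- The Jacobian at a point `x` of a map from a Riemannian submanifold to a Riemannian manifold of the
same dimension: `T` is the tangent space at `x`, `g` the metric on it, `h` the metric of the
target and `L` the differential. It is the factor by which `L` multiplies volumes, that is
the ratio of the volumes `√(det (h (L eᵢ) (L eⱼ)))` and `√(det (g eᵢ eⱼ))` for a basis `e` of `T`;
by `jacobianFactor_eq` the basis does not matter. -/
def jacobianFactor {V F : Type} [AddCommGroup V] [Module ℝ V] [FiniteDimensional ℝ V]
    [AddCommGroup F] [Module ℝ F] (T : Submodule ℝ V) (g : LinearMap.BilinForm ℝ V)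
    (h : LinearMap.BilinForm ℝ F) (L : V →ₗ[ℝ] F) : ℝ :=
  √(Matrix.of fun i j => h (L (Module.finBasis ℝ T i)) (L (Module.finBasis ℝ T j))).det /
    √(Matrix.of fun i j => g (Module.finBasis ℝ T i) (Module.finBasis ℝ T j)).det

theorem jacobianFactor_eq {V F : Type} [AddCommGroup V] [Module ℝ V] [FiniteDimensional ℝ V]
    [AddCommGroup F] [Module ℝ F] (T : Submodule ℝ V) (g : LinearMap.BilinForm ℝ V)
    (h : LinearMap.BilinForm ℝ F) (L : V →ₗ[ℝ] F) {κ : Type} [Fintype κ] [DecidableEq κ]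
    (e : Module.Basis κ ℝ T) :
    jacobianFactor T g h L =
      √(Matrix.of fun i j => h (L (e i)) (L (e j))).det / √(Matrix.of fun i j => g (e i) (e j)).det := by
  set b := Module.finBasis ℝ T
  let σ := b.indexEquiv e
  have key : ∀ B : LinearMap.BilinForm ℝ T,
      √(Matrix.of fun i j => B (b i) (b j)).det =
        |((b.reindex σ).toMatrix e).det|⁻¹ * √(Matrix.of fun i j => B (e i) (e j)).det := by
    intro B
    have h1 : (Matrix.of fun i j => B (b i) (b j)).det =
        (LinearMap.BilinForm.toMatrix (b.reindex σ) B).det := by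
      rw [← Matrix.det_submatrix_equiv_self σ]
      congr 1
      ext i j
      simp [LinearMap.BilinForm.toMatrix_apply]
    have h2 : (Matrix.of fun i j => B (e i) (e j)) = LinearMap.BilinForm.toMatrix e B := by
      ext i j
      simp [LinearMap.BilinForm.toMatrix_apply]
    have h3 := LinearMap.BilinForm.toMatrix_mul_basis_toMatrix (b := b.reindex σ) e B
    have h4 : ((b.reindex σ).toMatrix e).det ≠ 0 := by
      have := congrArg Matrix.det ((b.reindex σ).toMatrix_mul_toMatrix_flip e)
      rw [Matrix.det_mul, Matrix.det_one] at this
      exact left_ne_zero_of_mul_eq_one this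
    rw [h1, h2, ← h3, Matrix.det_mul, Matrix.det_mul, Matrix.det_transpose]
    have h5 : ∀ c d : ℝ, c ≠ 0 → √d = |c|⁻¹ * √(c * d * c) := by
      intro c d hc
      rw [show c * d * c = c ^ 2 * d by ring, Real.sqrt_mul (sq_nonneg c), Real.sqrt_sq_eq_abs,
        ← mul_assoc, inv_mul_cancel₀ (abs_ne_zero.2 hc), one_mul]
    exact h5 _ _ h4
  have k1 := key (h.comp (L ∘ₗ T.subtype) (L ∘ₗ T.subtype))
  have k2 := key (g.comp T.subtype T.subtype)
  have h4 : ((b.reindex σ).toMatrix e).det ≠ 0 := by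
    have := congrArg Matrix.det ((b.reindex σ).toMatrix_mul_toMatrix_flip e)
    rw [Matrix.det_mul, Matrix.det_one] at this
    exact left_ne_zero_of_mul_eq_one this
  simp only [LinearMap.BilinForm.comp_apply, LinearMap.comp_apply, Submodule.subtype_apply] at k1 k2
  unfold jacobianFactor
  rw [k1, k2]
  exact mul_div_mul_left _ _ (inv_ne_zero (abs_ne_zero.2 h4))

/-- The ambient linear space of the parameters `(a, b, θ, v, W)` of one step, which peels a
`2 × 2` block off a matrix indexed by `Fin 2 ⊕ m`. -/
abbrev Layer (m : Type) [Fintype m] [DecidableEq m] : Type :=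
  ℝ × ℝ × ℝ × Matrix (Fin 2 ⊕ m) (Fin 2) ℝ × Matrix m (Fin 2) ℝ

/-- The manifold `ℝ × (0, ∞) × (0, π/2) × V²(ℝ^(2+m)) × M_{m × 2}(ℝ)`. -/
def layerManifold (m : Type) [Fintype m] [DecidableEq m] : Set (Layer m) :=
  {p | 0 < p.2.1 ∧ p.2.2.1 ∈ Set.Ioo 0 (Real.pi / 2) ∧ p.2.2.2.1 ∈ stiefel (Fin 2 ⊕ m)}

/-- Its tangent space at `p`. -/
def layerTangent {m : Type} [Fintype m] [DecidableEq m] (p : Layer m) : Submodule ℝ (Layer m) :=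
  Submodule.prod ⊤ (Submodule.prod ⊤ (Submodule.prod ⊤
    (Submodule.prod (stiefelTangent p.2.2.2.1) ⊤)))

/-- The orthogonal sum of two bilinear forms. -/
def prodForm {V F : Type} [AddCommGroup V] [Module ℝ V] [AddCommGroup F] [Module ℝ F]
    (g : LinearMap.BilinForm ℝ V) (h : LinearMap.BilinForm ℝ F) : LinearMap.BilinForm ℝ (V × F) :=
  g.comp (LinearMap.fst ℝ V F) (LinearMap.fst ℝ V F) +
    h.comp (LinearMap.snd ℝ V F) (LinearMap.snd ℝ V F)

/-- The product metric at `p`, whose volume is `da db dθ dv dW`. -/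
def layerMetric {m : Type} [Fintype m] [DecidableEq m] (p : Layer m) :
    LinearMap.BilinForm ℝ (Layer m) :=
  prodForm (LinearMap.mul ℝ ℝ) (prodForm (LinearMap.mul ℝ ℝ) (prodForm (LinearMap.mul ℝ ℝ)
    (prodForm (stiefelMetric p.2.2.2.1) (frobeniusForm m (Fin 2)))))

/-- `Λ_{a,b,θ}`, with eigenvalues `a ± i b`. -/
def schurLambda (a b θ : ℝ) : Matrix (Fin 2) (Fin 2) ℝ :=
  !![a, b * Real.tan θ; -(b / Real.tan θ), a]

/-- One step: `R(v) (Λ_{a,b,θ}, Wᵀ; 0, M) R(v)ᵀ`. -/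
def schurStep {m : Type} [Fintype m] [DecidableEq m]
    (R : Matrix (Fin 2 ⊕ m) (Fin 2) ℝ → Matrix (Fin 2 ⊕ m) (Fin 2 ⊕ m) ℝ)
    (p : Layer m) (M : Matrix m m ℝ) : Matrix (Fin 2 ⊕ m) (Fin 2 ⊕ m) ℝ :=
  R p.2.2.2.1 * Matrix.fromBlocks (schurLambda p.1 p.2.1 p.2.2.1) p.2.2.2.2ᵀ 0 M * (R p.2.2.2.1)ᵀ

/-- `R` is defined and smooth on the part of the Stiefel manifold that lies in `U`, takes values there in
the orthogonal group, and `R(v) e_j = v_j` for the first two standard basis vectors. -/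
structure IsFrameCompletion {m : Type} [Fintype m] [DecidableEq m]
    (U : Set (Matrix (Fin 2 ⊕ m) (Fin 2) ℝ))
    (R : Matrix (Fin 2 ⊕ m) (Fin 2) ℝ → Matrix (Fin 2 ⊕ m) (Fin 2 ⊕ m) ℝ) : Prop where
  smooth : ContDiffOn ℝ ∞ R (stiefel (Fin 2 ⊕ m) ∩ U)
  orthogonal : ∀ v ∈ stiefel (Fin 2 ⊕ m) ∩ U, R v ∈ Matrix.orthogonalGroup (Fin 2 ⊕ m) ℝ
  column : ∀ v ∈ stiefel (Fin 2 ⊕ m) ∩ U, ∀ j : Fin 2,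
    R v *ᵥ Pi.single (Sum.inl j) 1 = fun i => v i j

/-- Ambient space of the parameters `((a₁, b₁, θ₁, v, W₁), (a₂, b₂, θ₂, u, W₂), M²)`. The matrix size is
`N = n + 4`, with rows and columns grouped into blocks of sizes `2`, `2` and `n`. -/
abbrev SchurParam (n : ℕ) : Type :=
  Layer (Fin 2 ⊕ Fin n) × Layer (Fin n) × Matrix (Fin n) (Fin n) ℝ

/-- The manifold `Ω = Ω₁ × Ω₂ × M_{N-4}(ℝ)`. -/
def schurManifold (n : ℕ) : Set (SchurParam n) :=
  layerManifold (Fin 2 ⊕ Fin n) ×ˢ layerManifold (Fin n) ×ˢ Set.univ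

def schurTangent {n : ℕ} (x : SchurParam n) : Submodule ℝ (SchurParam n) :=
  Submodule.prod (layerTangent x.1) (Submodule.prod (layerTangent x.2.1) ⊤)

/-- The product metric, whose volume is `da₁ db₁ dθ₁ dv dW₁ da₂ db₂ dθ₂ du dW₂ dM²`. -/
def schurMetric {n : ℕ} (x : SchurParam n) : LinearMap.BilinForm ℝ (SchurParam n) :=
  prodForm (layerMetric x.1) (prodForm (layerMetric x.2.1) (frobeniusForm (Fin n) (Fin n)))

/-- The partial Schur map `Φ`. -/
def schurMap {n : ℕ}
    (R₁ : Matrix (Fin 2 ⊕ (Fin 2 ⊕ Fin n)) (Fin 2) ℝ →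
      Matrix (Fin 2 ⊕ (Fin 2 ⊕ Fin n)) (Fin 2 ⊕ (Fin 2 ⊕ Fin n)) ℝ)
    (R₂ : Matrix (Fin 2 ⊕ Fin n) (Fin 2) ℝ → Matrix (Fin 2 ⊕ Fin n) (Fin 2 ⊕ Fin n) ℝ)
    (x : SchurParam n) : Matrix (Fin 2 ⊕ (Fin 2 ⊕ Fin n)) (Fin 2 ⊕ (Fin 2 ⊕ Fin n)) ℝ :=
  schurStep R₁ x.1 (schurStep R₂ x.2.1 x.2.2)

/-- The Jacobian `J(Φ)` at `x`, with respect to `da₁ db₁ dθ₁ dv dW₁ da₂ db₂ dθ₂ du dW₂ dM²` on `Ω` and Lebesgue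
measure on matrices. The differential is the derivative of `Φ` within `Ω`; only its restriction to the
tangent space of `Ω` is used, and this restriction is unique. -/
def schurJacobian {n : ℕ}
    (R₁ : Matrix (Fin 2 ⊕ (Fin 2 ⊕ Fin n)) (Fin 2) ℝ →
      Matrix (Fin 2 ⊕ (Fin 2 ⊕ Fin n)) (Fin 2 ⊕ (Fin 2 ⊕ Fin n)) ℝ)
    (R₂ : Matrix (Fin 2 ⊕ Fin n) (Fin 2) ℝ → Matrix (Fin 2 ⊕ Fin n) (Fin 2 ⊕ Fin n) ℝ)
    (x : SchurParam n) : ℝ :=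
  jacobianFactor (schurTangent x) (schurMetric x)
    (frobeniusForm (Fin 2 ⊕ (Fin 2 ⊕ Fin n)) (Fin 2 ⊕ (Fin 2 ⊕ Fin n)))
    (fderivWithin ℝ (schurMap R₁ R₂) (schurManifold n) x).toLinearMap

end

/-! The idea is to turn the Jacobian into the determinant of an endomorphism of the matrix space.
The tangent space of Ω has an isometric parametrization `E` by N×N matrices (`schurFrame`), so the
Jacobian is |det (dΦ ∘ E)| by `jacobianFactor_eq_abs_det`.

For one step Y = R S Rᵀ with S block triangular, put A = Rᵀ dR. Then Rᵀ dY R = [A, S] + dS, where A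
is skew and its first two columns are Rᵀ dv, that is, the infinitesimal rotation f = v₂ᵀ dv₁ and the
block H of the v_iᵀ dv_j with i > 2. Take the blocks in the order 21, 11, 12, 22. The differential
is then triangular: - block 21 is H Λ - M H, with determinant of absolute value |det(M - λ)|²
(`abs_det_sylvesterMap`); - modulo H, block 11 is dΛ + [fJ, Λ], where J is the rotation generator, a
4×4 determinant equal to 16 b² |cos 2θ| / sin² 2θ in absolute value (`abs_det_lambdaMap`); - modulo
f and H, blocks 12 and 22 are dWᵀ and dM.

The remaining block of A depends on the choice of R but enters only below the diagonal, so the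
result does not depend on R.

In two steps the 22 slot of the outer differential carries the inner one, so the determinants
multiply (`abs_det_schurStep`, used twice). The outer factor |det(M⁽¹⁾ - λ₁)|² splits over the
blocks of M⁽¹⁾, which produces |λ₁ - λ₂|² |λ₁ - λ̄₂|² (`norm_det_schurLambda_block`). -/

noncomputable section

/-! ### Jacobians as determinants in an isometric frame -/

namespace LinearMap

/-- The determinant of a block triangular endomorphism of a product. -/
theorem det_eq_mul_of_fst_comp {A B : Type*} [AddCommGroup A] [Module ℝ A] [FiniteDimensional ℝ A]
    [AddCommGroup B] [Module ℝ B] [FiniteDimensional ℝ B] (f : A × B →ₗ[ℝ] A × B)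
    (α : A →ₗ[ℝ] A) (β : B →ₗ[ℝ] B) (hα : ∀ x, (f x).1 = α x.1) (hβ : ∀ y, (f (0, y)).2 = β y) :
    f.det = α.det * β.det := by
  classical
  let a := Module.finBasis ℝ A
  let b := Module.finBasis ℝ B
  have h : LinearMap.toMatrix (a.prod b) (a.prod b) f =
      Matrix.fromBlocks (LinearMap.toMatrix a a α) 0
        (LinearMap.toMatrix a b (LinearMap.snd ℝ A B ∘ₗ f ∘ₗ LinearMap.inl ℝ A B))
        (LinearMap.toMatrix b b β) := by
    ext (i | i) (j | j) <;> simp [LinearMap.toMatrix_apply, hα, hβ]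
  rw [← LinearMap.det_toMatrix (a.prod b), h, Matrix.det_fromBlocks_zero₁₂, LinearMap.det_toMatrix,
    LinearMap.det_toMatrix]

end LinearMap

/-- The isometry `E` carries an orthonormal basis of `F` to one of `T`, so the source Gram
determinant is 1. The target Gram matrix is AᵀA with A the matrix of `L ∘ₗ E`. -/
theorem jacobianFactor_eq_abs_det {V F : Type} [AddCommGroup V] [Module ℝ V]
    [FiniteDimensional ℝ V] [AddCommGroup F] [Module ℝ F] (T : Submodule ℝ V)
    (g : LinearMap.BilinForm ℝ V) (h : LinearMap.BilinForm ℝ F) (L : V →ₗ[ℝ] F)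
    {κ : Type} [Fintype κ] [DecidableEq κ] (e : Module.Basis κ ℝ F)
    (he : ∀ i j, h (e i) (e j) = if i = j then 1 else 0) (E : F →ₗ[ℝ] V)
    (hE : LinearMap.range E = T) (hg : ∀ x y, g (E x) (E y) = h x y) :
    jacobianFactor T g h L = |(L ∘ₗ E).det| := by
  have hM : LinearMap.BilinForm.toMatrix e h = 1 := by
    ext i j
    simp [LinearMap.BilinForm.toMatrix_apply, he, Matrix.one_apply]
  have hinj : Function.Injective E := by
    rw [injective_iff_map_eq_zero]
    intro x hx
    apply e.repr.injective
    ext i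
    have h1 : h (e i) x = 0 := by rw [← hg, hx, map_zero]
    rw [← e.sum_repr x, map_sum] at h1
    simpa only [map_smul, he, smul_eq_mul, mul_ite, mul_one, mul_zero, Finset.sum_ite_eq,
      Finset.mem_univ, if_true, map_zero, Finsupp.coe_zero, Pi.zero_apply] using h1
  let Ψ : F ≃ₗ[ℝ] T := (LinearEquiv.ofInjective E hinj).trans (LinearEquiv.ofEq _ _ hE)
  have hΨ : ∀ x, (Ψ x : V) = E x := fun x => rfl
  rw [jacobianFactor_eq T g h L (e.map Ψ)]
  have h1 : (Matrix.of fun i j => g (e.map Ψ i) (e.map Ψ j)) = 1 := by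
    ext i j
    simp [hΨ, hg, he, Matrix.one_apply]
  have h2 : (Matrix.of fun i j => h (L (e.map Ψ i)) (L (e.map Ψ j))) =
      (LinearMap.toMatrix e e (L ∘ₗ E))ᵀ * LinearMap.toMatrix e e (L ∘ₗ E) := by
    have h3 := LinearMap.BilinForm.toMatrix_comp e e h (L ∘ₗ E) (L ∘ₗ E)
    rw [hM, Matrix.mul_one] at h3
    rw [← h3]
    ext i j
    simp [LinearMap.BilinForm.toMatrix_apply, hΨ]
  rw [h1, h2, Matrix.det_one, Real.sqrt_one, div_one, Matrix.det_mul, Matrix.det_transpose,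
    LinearMap.det_toMatrix, Real.sqrt_mul_self_eq_abs]

/-! ### The Frobenius form and block triangular determinants -/

theorem frobeniusForm_apply {ι κ : Type} [Fintype ι] [Fintype κ] (A B : Matrix ι κ ℝ) :
    frobeniusForm ι κ A B = (Aᵀ * B).trace := rfl

theorem frobeniusForm_stdBasis {ι κ : Type} [Fintype ι] [Fintype κ] [DecidableEq ι]
    [DecidableEq κ] (i j : ι × κ) :
    frobeniusForm ι κ (Matrix.stdBasis ℝ ι κ i) (Matrix.stdBasis ℝ ι κ j) =
      if i = j then 1 else 0 := by
  obtain ⟨i, i'⟩ := i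
  obtain ⟨j, j'⟩ := j
  rw [frobeniusForm_apply, Matrix.stdBasis_eq_single, Matrix.stdBasis_eq_single,
    Matrix.transpose_single]
  by_cases h : i = j
  · subst h
    by_cases h' : i' = j'
    · subst h'; simp
    · simp [h']
  · simp [h]

theorem frobeniusForm_conj {ι : Type} [Fintype ι] [DecidableEq ι] {Q : Matrix ι ι ℝ}
    (hQ : Qᵀ * Q = 1) (A B : Matrix ι ι ℝ) :
    frobeniusForm ι ι (Qᵀ * A * Q) (Qᵀ * B * Q) = frobeniusForm ι ι A B := by
  have h : Q * Qᵀ = 1 := mul_eq_one_comm.1 hQ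
  simp only [frobeniusForm_apply, Matrix.transpose_mul, Matrix.transpose_transpose]
  calc (Qᵀ * (Aᵀ * Q) * (Qᵀ * B * Q)).trace = (Qᵀ * (Aᵀ * (Q * Qᵀ) * B) * Q).trace := by
        simp only [Matrix.mul_assoc]
    _ = (Aᵀ * B).trace := by
        rw [h, Matrix.mul_one, Matrix.trace_mul_comm, ← Matrix.mul_assoc, h, Matrix.one_mul]

theorem frobeniusForm_blocks {m : Type} [Fintype m] (A B : Matrix (Fin 2 ⊕ m) (Fin 2 ⊕ m) ℝ) :
    frobeniusForm _ _ A B = frobeniusForm _ _ A.toBlocks₁₁ B.toBlocks₁₁ +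
      frobeniusForm _ _ A.toBlocks₁₂ B.toBlocks₁₂ + frobeniusForm _ _ A.toBlocks₂₁ B.toBlocks₂₁ +
      frobeniusForm _ _ A.toBlocks₂₂ B.toBlocks₂₂ := by
  simp only [frobeniusForm_apply, Matrix.trace, Matrix.diag, Matrix.mul_apply,
    Matrix.transpose_apply, Fintype.sum_sum_type, Finset.sum_add_distrib, Matrix.toBlocks₁₁,
    Matrix.toBlocks₁₂, Matrix.toBlocks₂₁, Matrix.toBlocks₂₂, Matrix.of_apply]
  ring

/-- The blocks of a matrix, in an order in which the differential of a Schur step is triangular. -/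
def blocksEquiv (m : Type) : Matrix (Fin 2 ⊕ m) (Fin 2 ⊕ m) ℝ ≃ₗ[ℝ]
    Matrix m (Fin 2) ℝ × Matrix (Fin 2) (Fin 2) ℝ × Matrix (Fin 2) m ℝ × Matrix m m ℝ where
  toFun Y := (Y.toBlocks₂₁, Y.toBlocks₁₁, Y.toBlocks₁₂, Y.toBlocks₂₂)
  invFun p := Matrix.fromBlocks p.2.1 p.2.2.1 p.1 p.2.2.2
  map_add' _ _ := rfl
  map_smul' _ _ := rfl
  left_inv Y := Matrix.fromBlocks_toBlocks Y
  right_inv p := by simp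

/-- Each hypothesis tests `f` only where the earlier blocks vanish, so entries below the diagonal
need no description. The 12 block contributes the determinant of the identity. -/
theorem det_of_blockTriangular {m : Type} [Fintype m]
    (f : Matrix (Fin 2 ⊕ m) (Fin 2 ⊕ m) ℝ →ₗ[ℝ] Matrix (Fin 2 ⊕ m) (Fin 2 ⊕ m) ℝ)
    (φ : Matrix m (Fin 2) ℝ →ₗ[ℝ] Matrix m (Fin 2) ℝ)
    (ψ : Matrix (Fin 2) (Fin 2) ℝ →ₗ[ℝ] Matrix (Fin 2) (Fin 2) ℝ)
    (N : Matrix m m ℝ →ₗ[ℝ] Matrix m m ℝ)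
    (h₂₁ : ∀ Y, (f Y).toBlocks₂₁ = φ Y.toBlocks₂₁)
    (h₁₁ : ∀ G W M, (f (Matrix.fromBlocks G W 0 M)).toBlocks₁₁ = ψ G)
    (h₁₂ : ∀ W M, (f (Matrix.fromBlocks 0 W 0 M)).toBlocks₁₂ = W)
    (h₂₂ : ∀ M, (f (Matrix.fromBlocks 0 0 0 M)).toBlocks₂₂ = N M) :
    f.det = φ.det * (ψ.det * N.det) := by
  let σ := blocksEquiv m
  let f₁ := σ.toLinearMap ∘ₗ f ∘ₗ σ.symm.toLinearMap
  let f₂ := LinearMap.snd ℝ _ _ ∘ₗ f₁ ∘ₗ LinearMap.inr ℝ _ _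
  let f₃ := LinearMap.snd ℝ _ _ ∘ₗ f₂ ∘ₗ LinearMap.inr ℝ _ _
  have e₁ : f₁.det = φ.det * f₂.det :=
    LinearMap.det_eq_mul_of_fst_comp f₁ φ f₂
      (fun x => h₂₁ (σ.symm x)) (fun y => rfl)
  have e₂ : f₂.det = ψ.det * f₃.det :=
    LinearMap.det_eq_mul_of_fst_comp f₂ ψ f₃ (fun x => h₁₁ x.1 x.2.1 x.2.2) (fun y => rfl)
  have e₃ : f₃.det = (LinearMap.id : Matrix (Fin 2) m ℝ →ₗ[ℝ] _).det * N.det :=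
    LinearMap.det_eq_mul_of_fst_comp f₃ _ N (fun x => h₁₂ x.1 x.2) (fun y => h₂₂ y)
  rw [← LinearMap.det_conj f σ, show σ.toLinearMap ∘ₗ f ∘ₗ σ.symm.toLinearMap = f₁ from rfl,
    e₁, e₂, e₃, LinearMap.det_id, one_mul]

/-! ### Determinants of the diagonal blocks -/

/-- For z = a + ib and real M, det(M - z̄) is the conjugate of det(M - z), and (M - z)(M - z̄) = (a
- M)² + b². -/
theorem norm_det_sub_smul_sq {m : Type} [Fintype m] [DecidableEq m] (M : Matrix m m ℝ) (a b : ℝ) :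
    ‖(M.map (fun x : ℝ => (x : ℂ)) - (a + b * Complex.I) • (1 : Matrix m m ℂ)).det‖ ^ 2 =
      ((a • (1 : Matrix m m ℝ) - M) * (a • (1 : Matrix m m ℝ) - M) +
        b ^ 2 • (1 : Matrix m m ℝ)).det := by
  set C : Matrix m m ℂ := M.map (fun x : ℝ => (x : ℂ)) with hC
  set z : ℂ := a + b * Complex.I with hz
  have h1 : (starRingEnd ℂ) (C - z • (1 : Matrix m m ℂ)).det =
      (C - (starRingEnd ℂ z) • (1 : Matrix m m ℂ)).det := by
    rw [RingHom.map_det]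
    congr 1
    ext i j
    by_cases h : i = j <;> simp [hC, h]
  have h2 : (C - z • (1 : Matrix m m ℂ)) * (C - (starRingEnd ℂ z) • (1 : Matrix m m ℂ)) =
      Complex.ofRealHom.mapMatrix ((a • (1 : Matrix m m ℝ) - M) * (a • (1 : Matrix m m ℝ) - M) +
        b ^ 2 • (1 : Matrix m m ℝ)) := by
    have hM : Complex.ofRealHom.mapMatrix M = C := rfl
    have hs : ∀ c : ℝ, Complex.ofRealHom.mapMatrix (c • (1 : Matrix m m ℝ)) =
        (c : ℂ) • (1 : Matrix m m ℂ) := by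
      intro c
      ext i j
      by_cases h : i = j <;> simp [h]
    have hz1 : starRingEnd ℂ z = a - b * Complex.I := by simp [hz, sub_eq_add_neg]
    have hI : Complex.I * Complex.I = -1 := Complex.I_mul_I
    rw [hz1, map_add, map_mul, map_sub (Complex.ofRealHom.mapMatrix), hM, hs, hs]
    simp only [hz, mul_sub, sub_mul, smul_mul_assoc, mul_smul_comm, one_mul, mul_one]
    match_scalars
    · ring
    · ring
    · linear_combination (b : ℂ) ^ 2 * (-hI)
  apply Complex.ofReal_injective
  rw [← Complex.ofRealHom_eq_coe, ← Complex.ofRealHom_eq_coe, RingHom.map_det, ← h2,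
    Matrix.det_mul, ← h1, Complex.mul_conj, Complex.normSq_eq_norm_sq]
  rfl

/-- The operator `H ↦ H Λ - M H`. -/
def sylvesterMap {m : Type} [Fintype m] (M : Matrix m m ℝ) (Λ : Matrix (Fin 2) (Fin 2) ℝ) :
    Matrix m (Fin 2) ℝ →ₗ[ℝ] Matrix m (Fin 2) ℝ where
  toFun H := H * Λ - M * H
  map_add' _ _ := by simp only [Matrix.add_mul, Matrix.mul_add]; abel
  map_smul' _ _ := by simp [smul_sub]

/-- Stacking the two columns of H turns the operator into a 2×2 block matrix with diagonal blocks T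
= a - M and scalar off-diagonal blocks. Its determinant is, up to sign, det(T² + pq) with pq = b².
-/
theorem abs_det_sylvesterMap {m : Type} [Fintype m] [DecidableEq m] (M : Matrix m m ℝ)
    (a b p q : ℝ) (hq : q ≠ 0) (hpq : p * q = b ^ 2) :
    |(sylvesterMap M !![a, p; -q, a]).det| =
      ‖(M.map (fun x : ℝ => (x : ℂ)) - (a + b * Complex.I) • (1 : Matrix m m ℂ)).det‖ ^ 2 := by
  let σ : Matrix m (Fin 2) ℝ ≃ₗ[ℝ] (m ⊕ m → ℝ) :=
    { toFun := fun H => Sum.elim (fun i => H i 0) (fun i => H i 1)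
      invFun := fun x => Matrix.of fun i => ![x (Sum.inl i), x (Sum.inr i)]
      map_add' := by intros; ext (i | i) <;> rfl
      map_smul' := by intros; ext (i | i) <;> rfl
      left_inv := by intro H; ext i j; fin_cases j <;> rfl
      right_inv := by intro x; ext (i | i) <;> rfl }
  let T : Matrix m m ℝ := a • 1 - M
  have h1 : (σ : _ →ₗ[ℝ] _) ∘ₗ sylvesterMap M !![a, p; -q, a] ∘ₗ (σ.symm : _ →ₗ[ℝ] _) =
      Matrix.toLin' (Matrix.fromBlocks T (-q • 1) (p • 1) T) := by
    apply LinearMap.ext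
    intro x
    ext (i | i)
    all_goals
      rw [Matrix.toLin'_apply, Matrix.fromBlocks_mulVec]
      simp only [T, Matrix.sub_mulVec, Matrix.smul_mulVec, Matrix.one_mulVec]
      simp [σ, sylvesterMap, Matrix.mul_apply, Matrix.mulVec, dotProduct]
      ring
  -- A unipotent column operation clears the upper left corner; here q must be invertible.
  have h2 : Matrix.fromBlocks T (-q • 1) (p • 1) T * Matrix.fromBlocks 1 0 (q⁻¹ • T) 1 =
      Matrix.fromBlocks 0 (-q • 1) (q⁻¹ • (T * T + b ^ 2 • 1)) T := by
    rw [Matrix.fromBlocks_multiply]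
    congr 1
    · simp [smul_smul, hq]
    · simp
    · simp only [Matrix.mul_one, Matrix.mul_smul, smul_add, smul_smul, ← hpq]
      rw [add_comm, show q⁻¹ * (p * q) = p by field_simp]
    · simp
  have h3 : |(Matrix.fromBlocks T (-q • 1) (p • 1) T).det| =
      |(q⁻¹ • (T * T + b ^ 2 • (1 : Matrix m m ℝ))).det * (-q • (1 : Matrix m m ℝ)).det| := by
    have h4 := congrArg Matrix.det h2
    rw [Matrix.det_mul, Matrix.det_fromBlocks_zero₁₂, Matrix.det_one, mul_one,
      mul_one] at h4
    -- Swapping the block rows makes the matrix triangular and changes only the sign, hence the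
    -- absolute values.
    have h5 : Matrix.fromBlocks 0 (-q • 1) (q⁻¹ • (T * T + b ^ 2 • 1)) T =
        (Matrix.fromBlocks (q⁻¹ • (T * T + b ^ 2 • 1)) T 0 (-q • 1)).submatrix
          (Equiv.sumComm m m) (Equiv.refl _) := by
      ext (i | i) (j | j) <;> rfl
    rw [h4, h5, ← Matrix.det_fromBlocks_zero₂₁ _ T]
    exact Matrix.abs_det_submatrix_equiv_equiv (Equiv.sumComm m m) (Equiv.refl _) _
  rw [norm_det_sub_smul_sq, ← LinearMap.det_conj _ σ, h1, LinearMap.det_toLin', h3,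
    ← Matrix.det_mul, Matrix.smul_mul, Matrix.mul_smul, smul_smul, Matrix.mul_one, Matrix.det_smul,
    show q⁻¹ * -q = -1 by field_simp, abs_mul, abs_pow, abs_neg, abs_one, one_pow, one_mul]
  rw [abs_of_nonneg]
  rw [← norm_det_sub_smul_sq]
  positivity

/-- Orthogonal conjugation drops out of the determinant, and the 2×2 block gives (a - z)² + pq = (z
- λ)(z - λ̄). This is used to factor det(M⁽¹⁾ - λ₁). -/
theorem norm_det_schurLambda_block {m : Type} [Fintype m] [DecidableEq m]
    {Q : Matrix (Fin 2 ⊕ m) (Fin 2 ⊕ m) ℝ} (hQ : Qᵀ * Q = 1) (a b p q : ℝ) (hpq : p * q = b ^ 2)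
    (W : Matrix (Fin 2) m ℝ) (M : Matrix m m ℝ) (z : ℂ) :
    ‖((Q * Matrix.fromBlocks !![a, p; -q, a] W 0 M * Qᵀ).map (fun x : ℝ => (x : ℂ)) -
        z • (1 : Matrix (Fin 2 ⊕ m) (Fin 2 ⊕ m) ℂ)).det‖ =
      ‖z - (a + b * Complex.I)‖ * ‖z - starRingEnd ℂ (a + b * Complex.I)‖ *
        ‖(M.map (fun x : ℝ => (x : ℂ)) - z • (1 : Matrix m m ℂ)).det‖ := by
  have hQ' : Q * Qᵀ = 1 := mul_eq_one_comm.1 hQ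
  let c := Complex.ofRealHom.mapMatrix (m := Fin 2 ⊕ m)
  have hc : c Q * c Qᵀ = 1 := by rw [← map_mul, hQ', map_one]
  have hc' : c Qᵀ * c Q = 1 := by rw [← map_mul, hQ, map_one]
  have h1 : (Q * Matrix.fromBlocks !![a, p; -q, a] W 0 M * Qᵀ).map (fun x : ℝ => (x : ℂ)) -
      z • (1 : Matrix (Fin 2 ⊕ m) (Fin 2 ⊕ m) ℂ) =
      c Q * (c (Matrix.fromBlocks !![a, p; -q, a] W 0 M) - z • 1) * c Qᵀ := by
    rw [mul_sub, sub_mul, mul_smul_comm, smul_mul_assoc, mul_one, hc, ← map_mul, ← map_mul]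
    rfl
  have h2 : c (Matrix.fromBlocks !![a, p; -q, a] W 0 M) - z • 1 =
      Matrix.fromBlocks !![a - z, (p : ℂ); -q, a - z] (W.map (fun x : ℝ => (x : ℂ))) 0
        (M.map (fun x : ℝ => (x : ℂ)) - z • (1 : Matrix m m ℂ)) := by
    ext (i | i) (j | j)
    · fin_cases i <;> fin_cases j <;> simp [c]
    · simp [c]
    · simp [c]
    · by_cases h : i = j <;> simp [c, h]
  have h3 : (c Q).det * (c Qᵀ).det = 1 := by rw [← Matrix.det_mul, hc, Matrix.det_one]
  rw [h1, Matrix.det_mul, Matrix.det_mul, mul_right_comm, h3, one_mul, h2,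
    Matrix.det_fromBlocks_zero₂₁, norm_mul]
  congr 1
  rw [← norm_mul]
  congr 1
  rw [Matrix.det_fin_two_of]
  have hpq' : (p : ℂ) * (q : ℂ) = (b : ℂ) ^ 2 := by exact_mod_cast hpq
  have hI : Complex.I * Complex.I = -1 := Complex.I_mul_I
  simp only [map_add, map_mul, Complex.conj_ofReal, Complex.conj_I]
  linear_combination hpq' + (b : ℂ) ^ 2 * hI

/-- The differential of `(a, b, θ, f) ↦ Λ_{a,b,θ} + [f J, Λ]`, with the parameters
arranged as the entries of a matrix. -/
def lambdaMap (p q p₁ q₁ p₂ q₂ : ℝ) :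
    Matrix (Fin 2) (Fin 2) ℝ →ₗ[ℝ] Matrix (Fin 2) (Fin 2) ℝ where
  toFun G := !![G 0 0 + G 1 1 * (q - p), G 0 1 * p₁ + G 1 0 * p₂;
    -(G 0 1 * q₁ + G 1 0 * q₂), G 0 0 - G 1 1 * (q - p)]
  map_add' _ _ := by ext i j; fin_cases i <;> fin_cases j <;> simp <;> ring
  map_smul' _ _ := by ext i j; fin_cases i <;> fin_cases j <;> simp <;> ring

/-- The diagonal entries of the image involve only the variables da and f, the off-diagonal ones
only db and dθ, so the 4×4 determinant is a product of two 2×2 ones. -/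
theorem det_lambdaMap (p q p₁ q₁ p₂ q₂ : ℝ) :
    (lambdaMap p q p₁ q₁ p₂ q₂).det = -(2 * (q - p)) * (p₂ * q₁ - p₁ * q₂) := by
  let σ : Matrix (Fin 2) (Fin 2) ℝ ≃ₗ[ℝ] (Fin 4 → ℝ) :=
    { toFun := fun G => ![G 0 0, G 0 1, G 1 0, G 1 1]
      invFun := fun x => !![x 0, x 1; x 2, x 3]
      map_add' := by intros; ext i; fin_cases i <;> rfl
      map_smul' := by intros; ext i; fin_cases i <;> rfl
      left_inv := by intro G; ext i j; fin_cases i <;> fin_cases j <;> rfl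
      right_inv := by intro x; ext i; fin_cases i <;> rfl }
  have h : σ.toLinearMap ∘ₗ lambdaMap p q p₁ q₁ p₂ q₂ ∘ₗ σ.symm.toLinearMap =
      Matrix.toLin' !![1, 0, 0, q - p; 0, p₁, p₂, 0; 0, -q₁, -q₂, 0; 1, 0, 0, -(q - p)] := by
    apply LinearMap.ext
    intro x
    ext i
    fin_cases i <;>
      simp [σ, lambdaMap, Matrix.mulVec, dotProduct, Fin.sum_univ_succ] <;> ring
  rw [← LinearMap.det_conj _ σ, h, LinearMap.det_toLin']
  simp [Matrix.det_succ_row_zero, Fin.sum_univ_succ, Fin.succAbove]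
  ring

/-! ### Curves in the parameter manifold and the differential of one step -/

section Calculus

attribute [local instance] Matrix.frobeniusNormedRing Matrix.frobeniusNormedAlgebra

theorem LinearMap.hasDerivAt_comp {E F : Type*} [NormedAddCommGroup E] [NormedSpace ℝ E]
    [FiniteDimensional ℝ E] [NormedAddCommGroup F] [NormedSpace ℝ F] (L : E →ₗ[ℝ] F)
    {f : ℝ → E} {f' : E} {t : ℝ} (hf : HasDerivAt f f' t) :
    HasDerivAt (fun s => L (f s)) (L f') t :=
  L.toContinuousLinearMap.hasFDerivAt.comp_hasDerivAt t hf

theorem LinearMap.differentiableWithinAt_comp {D E F : Type*} [NormedAddCommGroup D]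
    [NormedSpace ℝ D] [NormedAddCommGroup E] [NormedSpace ℝ E]
    [FiniteDimensional ℝ E] [NormedAddCommGroup F] [NormedSpace ℝ F] (L : E →ₗ[ℝ] F)
    {f : D → E} {s : Set D} {x : D} (hf : DifferentiableWithinAt ℝ f s x) :
    DifferentiableWithinAt ℝ (fun y => L (f y)) s x :=
  L.toContinuousLinearMap.differentiableAt.comp_differentiableWithinAt x hf

theorem mem_stiefelTangent {ι : Type} [Fintype ι] [DecidableEq ι] {v X : Matrix ι (Fin 2) ℝ} :
    X ∈ stiefelTangent v ↔ vᵀ * X + Xᵀ * v = 0 := Iff.rfl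

/-- Every tangent vector of the Stiefel manifold is the velocity of a curve in it. -/
theorem exists_curve_stiefel {ι : Type} [Fintype ι] [DecidableEq ι] {v X : Matrix ι (Fin 2) ℝ}
    (hv : v ∈ stiefel ι) (hX : X ∈ stiefelTangent v) :
    ∃ γ : ℝ → Matrix ι (Fin 2) ℝ, (∀ t, γ t ∈ stiefel ι) ∧ γ 0 = v ∧ HasDerivAt γ X 0 := by
  have hv : vᵀ * v = 1 := hv
  have hX : vᵀ * X = -(Xᵀ * v) := eq_neg_of_add_eq_zero_left (mem_stiefelTangent.1 hX)
  -- A skew B with B v = X; the last term cancels the surplus -v Xᵀ v. The curve is then exp(tB) v.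
  let B : Matrix ι ι ℝ := X * vᵀ - v * Xᵀ + v * (Xᵀ * v) * vᵀ
  have hB : Bᵀ = -B := by
    simp only [B, Matrix.transpose_add, Matrix.transpose_sub, Matrix.transpose_mul,
      Matrix.transpose_transpose, hX]
    simp only [Matrix.neg_mul, Matrix.mul_neg, Matrix.mul_assoc]
    abel
  have hBv : B * v = X := by
    simp only [B, Matrix.add_mul, Matrix.sub_mul, Matrix.mul_assoc, hv, Matrix.mul_one]
    abel
  let L : Matrix ι ι ℝ →ₗ[ℝ] Matrix ι (Fin 2) ℝ :=
    { toFun := fun A => A * v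
      map_add' := fun _ _ => Matrix.add_mul _ _ _
      map_smul' := fun _ _ => Matrix.smul_mul _ _ _ }
  refine ⟨fun t => L (NormedSpace.exp (t • B)), fun t => ?_, ?_, ?_⟩
  · have h : (NormedSpace.exp (t • B))ᵀ * NormedSpace.exp (t • B) = 1 := by
      rw [← Matrix.exp_transpose, Matrix.transpose_smul, hB, smul_neg, Matrix.exp_neg]
      exact Matrix.nonsing_inv_mul _
        ((Matrix.isUnit_iff_isUnit_det _).1 (Matrix.isUnit_exp _))
    change (NormedSpace.exp (t • B) * v)ᵀ * (NormedSpace.exp (t • B) * v) = 1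
    rw [Matrix.transpose_mul, Matrix.mul_assoc, ← Matrix.mul_assoc _ _ v, h, Matrix.one_mul, hv]
  · simp [L]
  · have h := L.hasDerivAt_comp (hasDerivAt_exp_smul_const (𝕂 := ℝ) B 0)
    have e : L (NormedSpace.exp ((0 : ℝ) • B) * B) = X := by simp [L, hBv]
    exact h.congr_deriv e

/-- The linear map that builds a block triangular matrix. -/
def schurBlock (m : Type) : (ℝ × ℝ × ℝ × Matrix m (Fin 2) ℝ × Matrix m m ℝ) →ₗ[ℝ]
    Matrix (Fin 2 ⊕ m) (Fin 2 ⊕ m) ℝ where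
  toFun x := Matrix.fromBlocks !![x.1, x.2.1; -x.2.2.1, x.1] x.2.2.2.1ᵀ 0 x.2.2.2.2
  map_add' x y := by
    rw [Matrix.fromBlocks_add]
    congr 1
    · ext i j; fin_cases i <;> fin_cases j <;> simp; ring
    · simp
  map_smul' c x := by
    rw [RingHom.id_apply, Matrix.fromBlocks_smul]
    congr 1
    · ext i j; fin_cases i <;> fin_cases j <;> simp
    · simp

variable {m : Type} [Fintype m] [DecidableEq m]

/-- The Schur step as a map on the product of all parameters. -/
def schurStepMap (R : Matrix (Fin 2 ⊕ m) (Fin 2) ℝ → Matrix (Fin 2 ⊕ m) (Fin 2 ⊕ m) ℝ)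
    (x : Layer m × Matrix m m ℝ) : Matrix (Fin 2 ⊕ m) (Fin 2 ⊕ m) ℝ :=
  schurStep R x.1 x.2

/-- Openness of `U` allows the restriction to `U` to be dropped. -/
theorem IsFrameCompletion.differentiableWithinAt {U : Set (Matrix (Fin 2 ⊕ m) (Fin 2) ℝ)}
    {R : Matrix (Fin 2 ⊕ m) (Fin 2) ℝ → Matrix (Fin 2 ⊕ m) (Fin 2 ⊕ m) ℝ}
    (hR : IsFrameCompletion U R) (hU : IsOpen U) {v : Matrix (Fin 2 ⊕ m) (Fin 2) ℝ}
    (hv : v ∈ stiefel (Fin 2 ⊕ m)) (hvU : v ∈ U) :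
    DifferentiableWithinAt ℝ R (stiefel (Fin 2 ⊕ m)) v :=
  (differentiableWithinAt_inter (hU.mem_nhds hvU)).1
    (hR.smooth.differentiableOn (by simp) v ⟨hv, hvU⟩)

theorem tan_pos_of_mem {θ : ℝ} (hθ : θ ∈ Set.Ioo 0 (Real.pi / 2)) : 0 < Real.tan θ :=
  Real.tan_pos_of_pos_of_lt_pi_div_two hθ.1 hθ.2

theorem cos_pos_of_mem {θ : ℝ} (hθ : θ ∈ Set.Ioo 0 (Real.pi / 2)) : 0 < Real.cos θ :=
  Real.cos_pos_of_mem_Ioo ⟨by linarith [hθ.1, Real.pi_pos], hθ.2⟩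

theorem sin_pos_of_mem {θ : ℝ} (hθ : θ ∈ Set.Ioo 0 (Real.pi / 2)) : 0 < Real.sin θ :=
  Real.sin_pos_of_pos_of_lt_pi hθ.1 (by linarith [hθ.2, Real.pi_pos])

theorem differentiableWithinAt_schurStepMap {U : Set (Matrix (Fin 2 ⊕ m) (Fin 2) ℝ)}
    {R : Matrix (Fin 2 ⊕ m) (Fin 2) ℝ → Matrix (Fin 2 ⊕ m) (Fin 2 ⊕ m) ℝ}
    (hR : IsFrameCompletion U R) (hU : IsOpen U) {p : Layer m} (hp : p ∈ layerManifold m)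
    (hpU : p.2.2.2.1 ∈ U) (M : Matrix m m ℝ) :
    DifferentiableWithinAt ℝ (schurStepMap R) (layerManifold m ×ˢ Set.univ) (p, M) := by
  obtain ⟨hb, hθ, hv⟩ := hp
  have hRd : DifferentiableWithinAt ℝ (fun x : Layer m × Matrix m m ℝ => R x.1.2.2.2.1)
      (layerManifold m ×ˢ Set.univ) (p, M) :=
    (hR.differentiableWithinAt hU hv hpU).comp (p, M)
      (f := fun x : Layer m × Matrix m m ℝ => x.1.2.2.2.1) (by fun_prop) (fun x hx => hx.1.2.2)
  have htan : DifferentiableWithinAt ℝ (fun x : Layer m × Matrix m m ℝ => Real.tan x.1.2.2.1)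
      (layerManifold m ×ˢ Set.univ) (p, M) :=
    DifferentiableAt.comp_differentiableWithinAt (p, M) (g := Real.tan)
      (f := fun x : Layer m × Matrix m m ℝ => x.1.2.2.1)
      (Real.differentiableAt_tan.2 (cos_pos_of_mem hθ).ne')
      (by fun_prop)
  have hbd : DifferentiableWithinAt ℝ (fun x : Layer m × Matrix m m ℝ => x.1.2.1)
      (layerManifold m ×ˢ Set.univ) (p, M) := by fun_prop
  have hS := (schurBlock m).differentiableWithinAt_comp
    (f := fun x : Layer m × Matrix m m ℝ => (x.1.1, x.1.2.1 * Real.tan x.1.2.2.1,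
      x.1.2.1 / Real.tan x.1.2.2.1, x.1.2.2.2.2, x.2)) (s := layerManifold m ×ˢ Set.univ)
    (x := (p, M)) (by
      refine DifferentiableWithinAt.prodMk (by fun_prop) (DifferentiableWithinAt.prodMk ?_
        (DifferentiableWithinAt.prodMk ?_ (by fun_prop)))
      · exact hbd.mul htan
      · simp_rw [div_eq_mul_inv]
        exact hbd.mul (htan.fun_inv (tan_pos_of_mem hθ).ne'))
  exact (hRd.mul hS).mul
    ((Matrix.transposeLinearEquiv _ _ ℝ ℝ).toLinearMap.differentiableWithinAt_comp hRd)

theorem IsFrameCompletion.transpose_mul_self {U : Set (Matrix (Fin 2 ⊕ m) (Fin 2) ℝ)}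
    {R : Matrix (Fin 2 ⊕ m) (Fin 2) ℝ → Matrix (Fin 2 ⊕ m) (Fin 2 ⊕ m) ℝ}
    (hR : IsFrameCompletion U R) {v : Matrix (Fin 2 ⊕ m) (Fin 2) ℝ}
    (hv : v ∈ stiefel (Fin 2 ⊕ m)) (hvU : v ∈ U) : (R v)ᵀ * R v = 1 := by
  simpa using (Matrix.mem_orthogonalGroup_iff' (A := R v)).1 (hR.orthogonal v ⟨hv, hvU⟩)

theorem IsFrameCompletion.mul_fromRows {U : Set (Matrix (Fin 2 ⊕ m) (Fin 2) ℝ)}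
    {R : Matrix (Fin 2 ⊕ m) (Fin 2) ℝ → Matrix (Fin 2 ⊕ m) (Fin 2 ⊕ m) ℝ}
    (hR : IsFrameCompletion U R) {v : Matrix (Fin 2 ⊕ m) (Fin 2) ℝ}
    (hv : v ∈ stiefel (Fin 2 ⊕ m)) (hvU : v ∈ U) :
    R v * (Matrix.fromRows 1 0 : Matrix (Fin 2 ⊕ m) (Fin 2) ℝ) = v := by
  ext i j
  have h := congrFun (hR.column v ⟨hv, hvU⟩ j) i
  rw [← h]
  simp [Matrix.mul_apply, Matrix.one_apply, Matrix.mulVec, dotProduct, Pi.single_apply]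

/-- The differential of a frame completion: `R⁻¹ dR` is skew-symmetric with first two columns
`R⁻¹ dv`. -/
theorem IsFrameCompletion.exists_deriv {U : Set (Matrix (Fin 2 ⊕ m) (Fin 2) ℝ)}
    {R : Matrix (Fin 2 ⊕ m) (Fin 2) ℝ → Matrix (Fin 2 ⊕ m) (Fin 2 ⊕ m) ℝ}
    (hR : IsFrameCompletion U R) (hU : IsOpen U) {v X : Matrix (Fin 2 ⊕ m) (Fin 2) ℝ}
    (hv : v ∈ stiefel (Fin 2 ⊕ m)) (hvU : v ∈ U) {γ : ℝ → Matrix (Fin 2 ⊕ m) (Fin 2) ℝ}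
    (hγ : ∀ t, γ t ∈ stiefel (Fin 2 ⊕ m)) (hγ0 : γ 0 = v) (hγ' : HasDerivAt γ X 0) :
    ∃ A : Matrix (Fin 2 ⊕ m) (Fin 2 ⊕ m) ℝ, Aᵀ = -A ∧
      A * (Matrix.fromRows 1 0 : Matrix (Fin 2 ⊕ m) (Fin 2) ℝ) = (R v)ᵀ * X ∧
      (X = 0 → A = 0) ∧ HasDerivAt (fun t => R (γ t)) (R v * A) 0 := by
  have hQ := hR.transpose_mul_self hv hvU
  have hQ' : R v * (R v)ᵀ = 1 := mul_eq_one_comm.1 hQ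
  have hd := (hR.differentiableWithinAt hU hv hvU).hasFDerivWithinAt
  set D := fderivWithin ℝ R (stiefel (Fin 2 ⊕ m)) v
  have h1 : HasDerivAt (fun t => R (γ t)) (D X) 0 := by
    rw [← hγ0] at hd
    exact hasDerivWithinAt_univ.1 (hd.comp_hasDerivWithinAt (0 : ℝ)
      (hγ'.hasDerivWithinAt (s := Set.univ)) (fun t _ => hγ t))
  have hev : ∀ᶠ t in nhds (0 : ℝ), γ t ∈ U :=
    hγ'.continuousAt.eventually (hU.mem_nhds (by rwa [hγ0]))
  have h2 := ((Matrix.transposeLinearEquiv _ _ ℝ ℝ).toLinearMap.hasDerivAt_comp h1).mul h1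
  -- Differentiate RᵀR = 1 along the curve, which stays in `U` for small t.
  have h3 : (D X)ᵀ * R v + (R v)ᵀ * D X = 0 := by
    have h4 := h2.congr_of_eventuallyEq (f₁ := fun _ => 1)
      (hev.mono fun t ht => (hR.transpose_mul_self (hγ t) ht).symm)
    have h5 := h4.unique (hasDerivAt_const 0 1)
    simpa [hγ0] using h5
  let L : Matrix (Fin 2 ⊕ m) (Fin 2 ⊕ m) ℝ →ₗ[ℝ] Matrix (Fin 2 ⊕ m) (Fin 2) ℝ :=
    { toFun := fun A => A * (Matrix.fromRows 1 0 : Matrix (Fin 2 ⊕ m) (Fin 2) ℝ)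
      map_add' := fun _ _ => Matrix.add_mul _ _ _
      map_smul' := fun _ _ => Matrix.smul_mul _ _ _ }
  -- Differentiate the identity saying that the first two columns of R(γ) are γ.
  have h6 : L (D X) = X := by
    have h4 := hγ'.congr_of_eventuallyEq (f₁ := fun t => L (R (γ t)))
      (hev.mono fun t ht => hR.mul_fromRows (hγ t) ht)
    exact (L.hasDerivAt_comp h1).unique h4
  refine ⟨(R v)ᵀ * D X, ?_, ?_, ?_, ?_⟩
  · rw [Matrix.transpose_mul, Matrix.transpose_transpose]
    exact eq_neg_of_add_eq_zero_left h3
  · rw [Matrix.mul_assoc]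
    exact congrArg _ h6
  · rintro rfl
    simp
  · rwa [← Matrix.mul_assoc, hQ', Matrix.one_mul]

theorem hasDerivAt_add_smul {E : Type*} [NormedAddCommGroup E] [NormedSpace ℝ E] (x y : E) :
    HasDerivAt (fun t : ℝ => x + t • y) y 0 := by
  simpa using ((hasDerivAt_id (0 : ℝ)).smul_const y).const_add x

/-- The curve in the parameter space of a layer which is `γ` in the frame and linear in the other
parameters. -/
def layerCurve (p ξ : Layer m) (γ : ℝ → Matrix (Fin 2 ⊕ m) (Fin 2) ℝ) (t : ℝ) : Layer m :=
  (p.1 + t • ξ.1, p.2.1 + t • ξ.2.1, p.2.2.1 + t • ξ.2.2.1, γ t, p.2.2.2.2 + t • ξ.2.2.2.2)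

theorem layerCurve_zero (p ξ : Layer m) {γ : ℝ → Matrix (Fin 2 ⊕ m) (Fin 2) ℝ}
    (hγ : γ 0 = p.2.2.2.1) : layerCurve p ξ γ 0 = p := by
  simp [layerCurve, hγ]

theorem hasDerivAt_layerCurve (p ξ : Layer m) {γ : ℝ → Matrix (Fin 2 ⊕ m) (Fin 2) ℝ}
    (hγ : HasDerivAt γ ξ.2.2.2.1 0) : HasDerivAt (layerCurve p ξ γ) ξ 0 :=
  (hasDerivAt_add_smul _ _).prodMk ((hasDerivAt_add_smul _ _).prodMk
    ((hasDerivAt_add_smul _ _).prodMk (hγ.prodMk (hasDerivAt_add_smul _ _))))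

theorem eventually_layerCurve_mem {p : Layer m} (hp : p ∈ layerManifold m) (ξ : Layer m)
    {γ : ℝ → Matrix (Fin 2 ⊕ m) (Fin 2) ℝ} (hγ : ∀ t, γ t ∈ stiefel (Fin 2 ⊕ m)) :
    ∀ᶠ t in nhds (0 : ℝ), layerCurve p ξ γ t ∈ layerManifold m := by
  have e1 : ∀ᶠ t in nhds (0 : ℝ), 0 < p.2.1 + t • ξ.2.1 :=
    (hasDerivAt_add_smul _ _).continuousAt.eventually (lt_mem_nhds (by simpa using hp.1))
  have e2 : ∀ᶠ t in nhds (0 : ℝ), p.2.2.1 + t • ξ.2.2.1 ∈ Set.Ioo 0 (Real.pi / 2) :=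
    (hasDerivAt_add_smul _ _).continuousAt.eventually
      (isOpen_Ioo.mem_nhds (by simpa using hp.2.1))
  filter_upwards [e1, e2] with t h1 h2
  exact ⟨h1, h2, hγ t⟩

theorem exists_curve_layer {p ξ : Layer m} (hp : p ∈ layerManifold m) (hξ : ξ ∈ layerTangent p) :
    ∃ x : ℝ → Layer m, x 0 = p ∧ HasDerivAt x ξ 0 ∧ ∀ᶠ t in nhds (0 : ℝ), x t ∈ layerManifold m := by
  obtain ⟨γ, hγ, hγ0, hγ'⟩ := exists_curve_stiefel hp.2.2 hξ.2.2.2.1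
  exact ⟨layerCurve p ξ γ, layerCurve_zero p ξ hγ0, hasDerivAt_layerCurve p ξ hγ',
    eventually_layerCurve_mem hp ξ hγ⟩

theorem HasFDerivWithinAt.hasDerivAt_comp_curve {E F : Type*} [NormedAddCommGroup E]
    [NormedSpace ℝ E] [NormedAddCommGroup F] [NormedSpace ℝ F] {f : E → F} {f' : E →L[ℝ] F}
    {s : Set E} {x : E} (hf : HasFDerivWithinAt f f' s x) {γ : ℝ → E} {ξ : E} (hγ0 : γ 0 = x)
    (hγ : HasDerivAt γ ξ 0) (hs : ∀ᶠ t in nhds (0 : ℝ), γ t ∈ s) :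
    HasDerivAt (fun t => f (γ t)) (f' ξ) 0 := by
  subst hγ0
  exact (hf.comp_hasDerivWithinAt (0 : ℝ) (hγ.hasDerivWithinAt (s := {t | γ t ∈ s}))
    (fun t ht => ht)).hasDerivAt hs

/-- The product rule for R S Rᵀ with dR = R A and Aᵀ = -A. The derivative within the manifold is
evaluated along a curve with velocity ξ. The clause that A vanishes with dv controls the part of A
that depends on the choice of R. -/
theorem fderivWithin_schurStepMap {U : Set (Matrix (Fin 2 ⊕ m) (Fin 2) ℝ)}
    {R : Matrix (Fin 2 ⊕ m) (Fin 2) ℝ → Matrix (Fin 2 ⊕ m) (Fin 2 ⊕ m) ℝ}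
    (hR : IsFrameCompletion U R) (hU : IsOpen U) {p : Layer m} (hp : p ∈ layerManifold m)
    (hpU : p.2.2.2.1 ∈ U) (M : Matrix m m ℝ) {ξ : Layer m} (hξ : ξ ∈ layerTangent p)
    (ζ : Matrix m m ℝ) (S : Matrix (Fin 2 ⊕ m) (Fin 2 ⊕ m) ℝ)
    (hS : S = Matrix.fromBlocks (schurLambda p.1 p.2.1 p.2.2.1) p.2.2.2.2ᵀ 0 M) :
    ∃ A : Matrix (Fin 2 ⊕ m) (Fin 2 ⊕ m) ℝ, Aᵀ = -A ∧
      A * (Matrix.fromRows 1 0 : Matrix (Fin 2 ⊕ m) (Fin 2) ℝ) = (R p.2.2.2.1)ᵀ * ξ.2.2.2.1 ∧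
      (ξ.2.2.2.1 = 0 → A = 0) ∧
      fderivWithin ℝ (schurStepMap R) (layerManifold m ×ˢ Set.univ) (p, M) (ξ, ζ) =
        R p.2.2.2.1 * (A * S - S * A + schurBlock m
          (ξ.1, ξ.2.1 * Real.tan p.2.2.1 + ξ.2.2.1 * (p.2.1 / Real.cos p.2.2.1 ^ 2),
            ξ.2.1 * (1 / Real.tan p.2.2.1) + ξ.2.2.1 * -(p.2.1 / Real.sin p.2.2.1 ^ 2),
            ξ.2.2.2.2, ζ)) * (R p.2.2.2.1)ᵀ := by
  obtain ⟨a, b, θ, v, W⟩ := p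
  obtain ⟨da, db, dθ, X, dW⟩ := ξ
  have hX : X ∈ stiefelTangent v := hξ.2.2.2.1
  have hd := (differentiableWithinAt_schurStepMap hR hU hp hpU M).hasFDerivWithinAt
  obtain ⟨hb, hθ, hv⟩ := hp
  change 0 < b at hb
  change θ ∈ Set.Ioo 0 (Real.pi / 2) at hθ
  change v ∈ stiefel _ at hv
  change v ∈ U at hpU
  dsimp only at hS ⊢
  have hc := cos_pos_of_mem hθ
  have hs := sin_pos_of_mem hθ
  have ht := tan_pos_of_mem hθ
  obtain ⟨γ, hγ, hγ0, hγ'⟩ := exists_curve_stiefel hv hX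
  obtain ⟨A, hA, hAc, hA0, hRd⟩ := hR.exists_deriv hU hv hpU hγ hγ0 hγ'
  refine ⟨A, hA, hAc, hA0, ?_⟩
  have ha' := hasDerivAt_add_smul a da
  have hb' := hasDerivAt_add_smul b db
  have hθ' := hasDerivAt_add_smul θ dθ
  have hW' := hasDerivAt_add_smul W dW
  have hM' := hasDerivAt_add_smul M ζ
  have k1 := hd.hasDerivAt_comp_curve
    (γ := fun t => (layerCurve (a, b, θ, v, W) (da, db, dθ, X, dW) γ t, M + t • ζ))
    (ξ := ((da, db, dθ, X, dW), ζ)) (by simp [layerCurve, hγ0])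
    ((hasDerivAt_layerCurve _ _ hγ').prodMk hM')
    ((eventually_layerCurve_mem ⟨hb, hθ, hv⟩ _ hγ).mono fun t ht => ⟨ht, trivial⟩)
  have htan : HasDerivAt (fun t : ℝ => Real.tan (θ + t • dθ)) (1 / Real.cos θ ^ 2 * dθ) 0 := by
    have h := Real.hasDerivAt_tan hc.ne'
    have h' : HasDerivAt Real.tan (1 / Real.cos θ ^ 2) (θ + (0 : ℝ) • dθ) := by simpa using h
    exact h'.comp (0 : ℝ) hθ'
  have hmul := hb'.mul htan
  have hdiv := hb'.div htan (by simpa using ht.ne')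
  have hSd := (schurBlock m).hasDerivAt_comp (ha'.prodMk (hmul.prodMk (hdiv.prodMk
    (hW'.prodMk hM'))))
  have k2 := (hRd.mul hSd).mul
    ((Matrix.transposeLinearEquiv _ _ ℝ ℝ).toLinearMap.hasDerivAt_comp hRd)
  refine (k1.unique k2).trans ?_
  have hS' : schurBlock m (a, b * Real.tan θ, b / Real.tan θ, W, M) = S := hS.symm
  have e1 : db * Real.tan θ + b * (1 / Real.cos θ ^ 2 * dθ) =
      db * Real.tan θ + dθ * (b / Real.cos θ ^ 2) := by ring
  -- Uses cos² θ tan² θ = sin² θ.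
  have e2 : (db * Real.tan θ - b * (1 / Real.cos θ ^ 2 * dθ)) / Real.tan θ ^ 2 =
      db * (1 / Real.tan θ) + dθ * -(b / Real.sin θ ^ 2) := by
    rw [Real.tan_eq_sin_div_cos]
    field_simp
    ring
  have hT : ∀ B : Matrix (Fin 2 ⊕ m) (Fin 2 ⊕ m) ℝ,
    (Matrix.transposeLinearEquiv _ _ ℝ ℝ).toLinearMap B = Bᵀ := fun _ => rfl
  simp only [Pi.mul_apply, Pi.div_apply, zero_smul, add_zero, hγ0, hT, hS', e1, e2]
  rw [Matrix.transpose_mul, hA]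
  simp only [Matrix.mul_add, Matrix.add_mul, Matrix.mul_sub, Matrix.sub_mul, Matrix.mul_assoc,
    Matrix.mul_neg, Matrix.neg_mul]
  abel

end Calculus

/-! ### Isometric frames and the determinant of one step -/

section Frame

variable {m : Type} [Fintype m] [DecidableEq m]

/-- Conjugation by an orthogonal matrix. -/
def orthogonalConj {ι : Type} [Fintype ι] [DecidableEq ι] (Q : Matrix ι ι ℝ) (hQ : Qᵀ * Q = 1) :
    Matrix ι ι ℝ ≃ₗ[ℝ] Matrix ι ι ℝ where
  toFun Z := Q * Z * Qᵀ
  invFun Y := Qᵀ * Y * Q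
  map_add' _ _ := by rw [Matrix.mul_add, Matrix.add_mul]
  map_smul' _ _ := by simp
  left_inv Z := by
    change Qᵀ * (Q * Z * Qᵀ) * Q = Z
    rw [Matrix.mul_assoc, Matrix.mul_assoc, hQ, Matrix.mul_one, ← Matrix.mul_assoc, hQ,
      Matrix.one_mul]
  right_inv Y := by
    have hQ' : Q * Qᵀ = 1 := mul_eq_one_comm.1 hQ
    change Q * (Qᵀ * Y * Q) * Qᵀ = Y
    rw [Matrix.mul_assoc, Matrix.mul_assoc, hQ', Matrix.mul_one, ← Matrix.mul_assoc, hQ',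
      Matrix.one_mul]

/-- The parametrization of the tangent space of a layer by matrices. -/
def layerFrame (Q : Matrix (Fin 2 ⊕ m) (Fin 2 ⊕ m) ℝ) :
    Matrix (Fin 2 ⊕ m) (Fin 2 ⊕ m) ℝ →ₗ[ℝ] Layer m × Matrix m m ℝ where
  toFun Z := ((Z.toBlocks₁₁ 0 0, Z.toBlocks₁₁ 0 1, Z.toBlocks₁₁ 1 0,
    Q * Matrix.fromRows !![0, -Z.toBlocks₁₁ 1 1; Z.toBlocks₁₁ 1 1, 0] Z.toBlocks₂₁,
    Z.toBlocks₁₂ᵀ), Z.toBlocks₂₂)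
  map_add' Y Z := by
    simp only [Prod.mk_add_mk, ← Matrix.mul_add, Prod.mk.injEq]
    refine ⟨⟨rfl, rfl, rfl, ?_, rfl⟩, rfl⟩
    congr 1
    ext (i | i) j
    · fin_cases i <;> fin_cases j <;> simp [Matrix.toBlocks₁₁]; ring
    · rfl
  map_smul' c Z := by
    simp only [Prod.smul_mk, ← Matrix.mul_smul, Prod.mk.injEq, RingHom.id_apply]
    refine ⟨⟨rfl, rfl, rfl, ?_, rfl⟩, rfl⟩
    congr 1
    ext (i | i) j
    · fin_cases i <;> fin_cases j <;> simp [Matrix.toBlocks₁₁]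
    · rfl

theorem prodForm_apply {V F : Type} [AddCommGroup V] [Module ℝ V] [AddCommGroup F] [Module ℝ F]
    (g : LinearMap.BilinForm ℝ V) (h : LinearMap.BilinForm ℝ F) (x y : V × F) :
    prodForm g h x y = g x.1 y.1 + h x.2 y.2 := rfl

/-- The four entries of the 11 block serve as da, db, dθ and f. By `stiefelMetric_frame` the
coordinates f and H are orthonormal, so all entries have unit weight. -/
theorem prodForm_layerFrame {Q : Matrix (Fin 2 ⊕ m) (Fin 2 ⊕ m) ℝ} (hQ : Qᵀ * Q = 1) (p : Layer m)
    (hp : Q * (Matrix.fromRows 1 0 : Matrix (Fin 2 ⊕ m) (Fin 2) ℝ) = p.2.2.2.1)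
    (Y Z : Matrix (Fin 2 ⊕ m) (Fin 2 ⊕ m) ℝ) :
    prodForm (layerMetric p) (frobeniusForm m m) (layerFrame Q Y) (layerFrame Q Z) =
      frobeniusForm _ _ Y Z := by
  have hQ' : Q ∈ Matrix.orthogonalGroup (Fin 2 ⊕ m) ℝ :=
    (Matrix.mem_orthogonalGroup_iff' ..).2 (by simpa using hQ)
  have h := stiefelMetric_frame Q hQ' (Y.toBlocks₁₁ 1 1) (Z.toBlocks₁₁ 1 1)
    Y.toBlocks₂₁ Z.toBlocks₂₁
  rw [hp] at h
  have ht : frobeniusForm _ _ Y.toBlocks₁₂ᵀ Z.toBlocks₁₂ᵀ =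
      frobeniusForm _ _ Y.toBlocks₁₂ Z.toBlocks₁₂ := by
    rw [frobeniusForm_apply, frobeniusForm_apply, Matrix.transpose_transpose,
      ← Matrix.trace_transpose, Matrix.transpose_mul, Matrix.transpose_transpose,
      Matrix.trace_mul_comm, ← Matrix.trace_transpose, Matrix.transpose_mul,
      Matrix.transpose_transpose, ← Matrix.trace_transpose, Matrix.transpose_mul,
      Matrix.transpose_transpose]
  rw [frobeniusForm_blocks Y Z]
  simp only [layerMetric, prodForm_apply, layerFrame, LinearMap.coe_mk, AddHom.coe_mk, h, ht,
    LinearMap.mul_apply']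
  rw [frobeniusForm_apply Y.toBlocks₁₁, frobeniusForm_apply Y.toBlocks₂₁]
  simp only [Matrix.trace_fin_two, Matrix.mul_apply, Fin.sum_univ_two, Matrix.transpose_apply]
  ring

/-- X is tangent exactly when the top 2×2 block of QᵀX is skew, hence given by a single number f. -/
theorem range_layerFrame {Q : Matrix (Fin 2 ⊕ m) (Fin 2 ⊕ m) ℝ} (hQ : Qᵀ * Q = 1) (p : Layer m)
    (hp : Q * (Matrix.fromRows 1 0 : Matrix (Fin 2 ⊕ m) (Fin 2) ℝ) = p.2.2.2.1) :
    LinearMap.range (layerFrame Q) = (layerTangent p).prod ⊤ := by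
  have hQ' : Q * Qᵀ = 1 := mul_eq_one_comm.1 hQ
  have key : ∀ X : Matrix (Fin 2 ⊕ m) (Fin 2) ℝ, X ∈ stiefelTangent p.2.2.2.1 ↔
      (Qᵀ * X).toRows₁ + (Qᵀ * X).toRows₁ᵀ = 0 := by
    intro X
    have h1 : p.2.2.2.1ᵀ * X = (Qᵀ * X).toRows₁ := by
      rw [← hp, Matrix.transpose_mul, Matrix.mul_assoc]
      conv_lhs => rw [← Matrix.fromRows_toRows (Qᵀ * X)]
      rw [Matrix.transpose_fromRows, Matrix.fromCols_mul_fromRows]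
      simp
    have h2 : Xᵀ * p.2.2.2.1 = (Qᵀ * X).toRows₁ᵀ := by
      rw [← h1, Matrix.transpose_mul, Matrix.transpose_transpose]
    rw [mem_stiefelTangent, h1, h2]
  apply le_antisymm
  · rintro _ ⟨Z, rfl⟩
    refine ⟨⟨trivial, trivial, trivial, ?_, trivial⟩, trivial⟩
    apply (key _).2
    simp only [layerFrame, LinearMap.coe_mk, AddHom.coe_mk]
    rw [← Matrix.mul_assoc, hQ, Matrix.one_mul, Matrix.toRows₁_fromRows]
    ext i j
    fin_cases i <;> fin_cases j <;> simp
  · rintro ⟨⟨a, b, θ, X, W⟩, M⟩ ⟨⟨-, -, -, hX, -⟩, -⟩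
    have hX' := (key X).1 hX
    set Y := Qᵀ * X with hY
    refine ⟨Matrix.fromBlocks !![a, b; θ, Y (Sum.inl 1) 0] Wᵀ Y.toRows₂ M, ?_⟩
    have h3 : X = Q * Y := by rw [hY, ← Matrix.mul_assoc, hQ', Matrix.one_mul]
    have h4 : (Matrix.fromRows !![0, -Y (Sum.inl 1) 0; Y (Sum.inl 1) 0, 0] Y.toRows₂ :
        Matrix (Fin 2 ⊕ m) (Fin 2) ℝ) = Y := by
      conv_rhs => rw [← Matrix.fromRows_toRows Y]
      congr 1
      have e := fun i j => congrFun (congrFun hX' i) j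
      have e00 := e 0 0
      have e01 := e 0 1
      have e11 := e 1 1
      simp only [Matrix.add_apply, Matrix.transpose_apply, Matrix.toRows₁_apply,
        Matrix.zero_apply] at e00 e01 e11
      ext i j
      fin_cases i <;> fin_cases j <;> simp <;> linarith
    simp [layerFrame, h4, ← h3]

theorem eq_fromBlocks_of_skew {m : Type} [Fintype m]
    {A : Matrix (Fin 2 ⊕ m) (Fin 2 ⊕ m) ℝ} (hA : Aᵀ = -A)
    {K : Matrix (Fin 2) (Fin 2) ℝ} {H : Matrix m (Fin 2) ℝ}
    (h : A * (Matrix.fromRows 1 0 : Matrix (Fin 2 ⊕ m) (Fin 2) ℝ) = Matrix.fromRows K H) :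
    A = Matrix.fromBlocks K (-Hᵀ) H A.toBlocks₂₂ := by
  have h1 : Matrix.fromRows A.toBlocks₁₁ A.toBlocks₂₁ = Matrix.fromRows K H := by
    rw [← h]
    conv_rhs => rw [← Matrix.fromBlocks_toBlocks A]
    rw [Matrix.fromBlocks_mul_fromRows]
    simp
  obtain ⟨rfl, rfl⟩ := Matrix.fromRows_inj h1
  conv_lhs => rw [← Matrix.fromBlocks_toBlocks A]
  congr 1
  ext i j
  have := congrFun (congrFun hA (Sum.inl i)) (Sum.inr j)
  simp only [Matrix.transpose_apply, Matrix.neg_apply] at this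
  simp [Matrix.toBlocks₁₂, Matrix.toBlocks₂₁, this]

/-- The two factors are -2b(cot θ - tan θ) = -4b cos 2θ / sin 2θ and 2b / (sin θ cos θ) = 4b / sin
2θ. -/
theorem abs_det_lambdaMap {b θ : ℝ} (hθ : θ ∈ Set.Ioo 0 (Real.pi / 2)) :
    |(lambdaMap (b * Real.tan θ) (b / Real.tan θ) (Real.tan θ) (1 / Real.tan θ)
      (b / Real.cos θ ^ 2) (-(b / Real.sin θ ^ 2))).det| =
      16 * b ^ 2 * |Real.cos (2 * θ)| / Real.sin (2 * θ) ^ 2 := by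
  have hc := cos_pos_of_mem hθ
  have hs := sin_pos_of_mem hθ
  have h1 : (lambdaMap (b * Real.tan θ) (b / Real.tan θ) (Real.tan θ) (1 / Real.tan θ)
      (b / Real.cos θ ^ 2) (-(b / Real.sin θ ^ 2))).det =
      -(16 * b ^ 2 / Real.sin (2 * θ) ^ 2) * Real.cos (2 * θ) := by
    rw [det_lambdaMap, Real.tan_eq_sin_div_cos, Real.sin_two_mul, Real.cos_two_mul']
    field_simp
    ring
  rw [h1, abs_mul, abs_neg, abs_of_nonneg (by positivity)]
  ring

/-- The map `N` stands for whatever produces dM from the 22 block. It is the identity for the inner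
step and the differential of the inner step for the outer one, so one statement serves both. -/
theorem abs_det_schurStep {U : Set (Matrix (Fin 2 ⊕ m) (Fin 2) ℝ)}
    {R : Matrix (Fin 2 ⊕ m) (Fin 2) ℝ → Matrix (Fin 2 ⊕ m) (Fin 2 ⊕ m) ℝ}
    (hR : IsFrameCompletion U R) (hU : IsOpen U) {p : Layer m} (hp : p ∈ layerManifold m)
    (hpU : p.2.2.2.1 ∈ U) (M : Matrix m m ℝ) (N : Matrix m m ℝ →ₗ[ℝ] Matrix m m ℝ)
    (hQ : (R p.2.2.2.1)ᵀ * R p.2.2.2.1 = 1)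
    (f : Matrix (Fin 2 ⊕ m) (Fin 2 ⊕ m) ℝ →ₗ[ℝ] Matrix (Fin 2 ⊕ m) (Fin 2 ⊕ m) ℝ)
    (hf : ∀ Y, f Y = fderivWithin ℝ (schurStepMap R) (layerManifold m ×ˢ Set.univ) (p, M)
      ((layerFrame (R p.2.2.2.1) ((orthogonalConj _ hQ).symm Y)).1,
        N (layerFrame (R p.2.2.2.1) ((orthogonalConj _ hQ).symm Y)).2)) :
    |f.det| = 16 * p.2.1 ^ 2 * |Real.cos (2 * p.2.2.1)| / Real.sin (2 * p.2.2.1) ^ 2 *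
      ‖(M.map (fun x : ℝ => (x : ℂ)) - (p.1 + p.2.1 * Complex.I) • (1 : Matrix m m ℂ)).det‖ ^ 2 *
      |N.det| := by
  have hcol := hR.mul_fromRows hp.2.2 hpU
  set Q := R p.2.2.2.1 with hQdef
  let σ := orthogonalConj Q hQ
  -- Conjugation by σ strips the outer factors Q and Qᵀ and leaves [A, S] + dS, with the same
  -- determinant.
  let g := σ.symm.toLinearMap ∘ₗ f ∘ₗ σ.toLinearMap
  have hg : g.det = f.det := LinearMap.det_conj f σ.symm
  let S := Matrix.fromBlocks (schurLambda p.1 p.2.1 p.2.2.1) p.2.2.2.2ᵀ 0 M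
  let T : Matrix (Fin 2 ⊕ m) (Fin 2 ⊕ m) ℝ → Matrix (Fin 2 ⊕ m) (Fin 2 ⊕ m) ℝ := fun Z =>
    schurBlock m (Z.toBlocks₁₁ 0 0,
      Z.toBlocks₁₁ 0 1 * Real.tan p.2.2.1 + Z.toBlocks₁₁ 1 0 * (p.2.1 / Real.cos p.2.2.1 ^ 2),
      Z.toBlocks₁₁ 0 1 * (1 / Real.tan p.2.2.1) +
        Z.toBlocks₁₁ 1 0 * -(p.2.1 / Real.sin p.2.2.1 ^ 2), Z.toBlocks₁₂ᵀ, N Z.toBlocks₂₂)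
  -- B is the block of A that depends on the choice of R. Triangularity needs only that it vanishes
  -- together with f and H.
  have key : ∀ Z, ∃ B : Matrix m m ℝ, (Z.toBlocks₁₁ 1 1 = 0 → Z.toBlocks₂₁ = 0 → B = 0) ∧
      g Z = Matrix.fromBlocks !![0, -Z.toBlocks₁₁ 1 1; Z.toBlocks₁₁ 1 1, 0] (-Z.toBlocks₂₁ᵀ)
        Z.toBlocks₂₁ B * S - S * Matrix.fromBlocks !![0, -Z.toBlocks₁₁ 1 1; Z.toBlocks₁₁ 1 1, 0]
          (-Z.toBlocks₂₁ᵀ) Z.toBlocks₂₁ B + T Z := by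
    intro Z
    have hξ : (layerFrame Q Z).1 ∈ layerTangent p := by
      have : layerFrame Q Z ∈ (layerTangent p).prod ⊤ := by
        rw [← range_layerFrame hQ p hcol]
        exact LinearMap.mem_range_self _ _
      exact this.1
    obtain ⟨A, hA, hAc, hA0, hd⟩ :=
      fderivWithin_schurStepMap hR hU hp hpU M hξ (N Z.toBlocks₂₂) S rfl
    have hX : (layerFrame Q Z).1.2.2.2.1 =
        Q * Matrix.fromRows !![0, -Z.toBlocks₁₁ 1 1; Z.toBlocks₁₁ 1 1, 0] Z.toBlocks₂₁ := rfl
    rw [← hQdef, hX, ← Matrix.mul_assoc, hQ, Matrix.one_mul] at hAc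
    have hA' := eq_fromBlocks_of_skew hA hAc
    refine ⟨A.toBlocks₂₂, ?_, ?_⟩
    · intro h1 h2
      have : A = 0 := by
        apply hA0
        rw [hX, h1, h2]
        have : (Matrix.fromRows !![0, -0; 0, 0] 0 : Matrix (Fin 2 ⊕ m) (Fin 2) ℝ) = 0 := by
          ext (i | i) j
          · fin_cases i <;> fin_cases j <;> simp
          · rfl
        rw [this, Matrix.mul_zero]
      rw [this]
      rfl
    · rw [← hA']
      have h1 : g Z = σ.symm (f (σ Z)) := rfl
      have h2 : f (σ Z) = σ (A * S - S * A + T Z) := by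
        rw [hf]
        change fderivWithin ℝ (schurStepMap R) (layerManifold m ×ˢ Set.univ) (p, M)
          ((layerFrame Q (σ.symm (σ Z))).1, N (layerFrame Q (σ.symm (σ Z))).2) = _
        rw [LinearEquiv.symm_apply_apply]
        exact hd
      rw [h1, h2, LinearEquiv.symm_apply_apply]
  have hdet := det_of_blockTriangular g
    (sylvesterMap M (schurLambda p.1 p.2.1 p.2.2.1))
    (lambdaMap (p.2.1 * Real.tan p.2.2.1) (p.2.1 / Real.tan p.2.2.1) (Real.tan p.2.2.1)
      (1 / Real.tan p.2.2.1) (p.2.1 / Real.cos p.2.2.1 ^ 2) (-(p.2.1 / Real.sin p.2.2.1 ^ 2))) N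
    (fun Z => by
      obtain ⟨B, -, h⟩ := key Z
      rw [h]
      simp only [S, T, schurBlock, LinearMap.coe_mk, AddHom.coe_mk, Matrix.fromBlocks_multiply,
        sub_eq_add_neg, Matrix.fromBlocks_neg, Matrix.fromBlocks_add, Matrix.toBlocks_fromBlocks₂₁]
      simp [sylvesterMap, sub_eq_add_neg])
    (fun G W C => by
      obtain ⟨B, -, h⟩ := key (Matrix.fromBlocks G W 0 C)
      rw [h]
      simp only [S, T, schurBlock, LinearMap.coe_mk, AddHom.coe_mk, Matrix.fromBlocks_multiply,
        sub_eq_add_neg, Matrix.fromBlocks_neg, Matrix.fromBlocks_add, Matrix.toBlocks_fromBlocks₁₁,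
        Matrix.toBlocks_fromBlocks₂₁]
      ext i j
      fin_cases i <;> fin_cases j <;>
        simp [lambdaMap, schurLambda] <;> ring)
    (fun W C => by
      obtain ⟨B, hB, h⟩ := key (Matrix.fromBlocks 0 W 0 C)
      rw [h, hB (by simp) (by simp)]
      simp only [S, T, schurBlock, LinearMap.coe_mk, AddHom.coe_mk, Matrix.fromBlocks_multiply,
        sub_eq_add_neg, Matrix.fromBlocks_neg, Matrix.fromBlocks_add, Matrix.toBlocks_fromBlocks₁₁,
        Matrix.toBlocks_fromBlocks₂₁, Matrix.toBlocks_fromBlocks₁₂]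
      have : (!![0, -(0 : Matrix (Fin 2) (Fin 2) ℝ) 1 1; (0 : Matrix (Fin 2) (Fin 2) ℝ) 1 1, 0] :
        Matrix (Fin 2) (Fin 2) ℝ) = 0 := by
        ext i j
        fin_cases i <;> fin_cases j <;> simp
      simp only [this]
      simp)
    (fun C => by
      obtain ⟨B, hB, h⟩ := key (Matrix.fromBlocks 0 0 0 C)
      rw [h, hB (by simp) (by simp)]
      simp only [S, T, schurBlock, LinearMap.coe_mk, AddHom.coe_mk, Matrix.fromBlocks_multiply,
        sub_eq_add_neg, Matrix.fromBlocks_neg, Matrix.fromBlocks_add, Matrix.toBlocks_fromBlocks₂₂,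
        Matrix.toBlocks_fromBlocks₂₁]
      simp)
  have ht := tan_pos_of_mem hp.2.1
  rw [← hg, hdet, abs_mul, abs_mul, abs_det_lambdaMap hp.2.1, schurLambda,
    abs_det_sylvesterMap M p.1 p.2.1 _ _ (div_pos hp.1 ht).ne' (by field_simp)]
  ring

end Frame

/-! ### Composition of the two steps -/

/-- The parametrization of the tangent space of the parameter manifold by matrices. -/
def schurFrame {n : ℕ} (Q₁ : Matrix (Fin 2 ⊕ (Fin 2 ⊕ Fin n)) (Fin 2 ⊕ (Fin 2 ⊕ Fin n)) ℝ)
    (hQ₁ : Q₁ᵀ * Q₁ = 1) (Q₂ : Matrix (Fin 2 ⊕ Fin n) (Fin 2 ⊕ Fin n) ℝ) (hQ₂ : Q₂ᵀ * Q₂ = 1) :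
    Matrix (Fin 2 ⊕ (Fin 2 ⊕ Fin n)) (Fin 2 ⊕ (Fin 2 ⊕ Fin n)) ℝ →ₗ[ℝ] SchurParam n :=
  LinearMap.prodMap LinearMap.id (layerFrame Q₂ ∘ₗ (orthogonalConj Q₂ hQ₂).symm.toLinearMap) ∘ₗ
    layerFrame Q₁ ∘ₗ (orthogonalConj Q₁ hQ₁).symm.toLinearMap

theorem layerFrame_conj_isometry {m : Type} [Fintype m] [DecidableEq m]
    {Q : Matrix (Fin 2 ⊕ m) (Fin 2 ⊕ m) ℝ} (hQ : Qᵀ * Q = 1) (p : Layer m)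
    (hp : Q * (Matrix.fromRows 1 0 : Matrix (Fin 2 ⊕ m) (Fin 2) ℝ) = p.2.2.2.1)
    (Y Z : Matrix (Fin 2 ⊕ m) (Fin 2 ⊕ m) ℝ) :
    prodForm (layerMetric p) (frobeniusForm m m) (layerFrame Q ((orthogonalConj Q hQ).symm Y))
      (layerFrame Q ((orthogonalConj Q hQ).symm Z)) = frobeniusForm _ _ Y Z := by
  rw [prodForm_layerFrame hQ p hp]
  exact frobeniusForm_conj hQ Y Z

/-- The outer frame is an isometry onto layer and 22 block, and the inner frame is an isometry on
that 22 block. -/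
theorem schurMetric_schurFrame {n : ℕ} (x : SchurParam n)
    {Q₁ : Matrix (Fin 2 ⊕ (Fin 2 ⊕ Fin n)) (Fin 2 ⊕ (Fin 2 ⊕ Fin n)) ℝ}
    (hQ₁ : Q₁ᵀ * Q₁ = 1) {Q₂ : Matrix (Fin 2 ⊕ Fin n) (Fin 2 ⊕ Fin n) ℝ} (hQ₂ : Q₂ᵀ * Q₂ = 1)
    (h₁ : Q₁ * (Matrix.fromRows 1 0 : Matrix (Fin 2 ⊕ (Fin 2 ⊕ Fin n)) (Fin 2) ℝ) = x.1.2.2.2.1)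
    (h₂ : Q₂ * (Matrix.fromRows 1 0 : Matrix (Fin 2 ⊕ Fin n) (Fin 2) ℝ) = x.2.1.2.2.2.1)
    (Y Z : Matrix (Fin 2 ⊕ (Fin 2 ⊕ Fin n)) (Fin 2 ⊕ (Fin 2 ⊕ Fin n)) ℝ) :
    schurMetric x (schurFrame Q₁ hQ₁ Q₂ hQ₂ Y) (schurFrame Q₁ hQ₁ Q₂ hQ₂ Z) =
      frobeniusForm _ _ Y Z := by
  rw [← layerFrame_conj_isometry hQ₁ x.1 h₁ Y Z, prodForm_apply,
    ← layerFrame_conj_isometry hQ₂ x.2.1 h₂]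
  rfl

theorem range_schurFrame {n : ℕ} (x : SchurParam n)
    {Q₁ : Matrix (Fin 2 ⊕ (Fin 2 ⊕ Fin n)) (Fin 2 ⊕ (Fin 2 ⊕ Fin n)) ℝ}
    (hQ₁ : Q₁ᵀ * Q₁ = 1) {Q₂ : Matrix (Fin 2 ⊕ Fin n) (Fin 2 ⊕ Fin n) ℝ} (hQ₂ : Q₂ᵀ * Q₂ = 1)
    (h₁ : Q₁ * (Matrix.fromRows 1 0 : Matrix (Fin 2 ⊕ (Fin 2 ⊕ Fin n)) (Fin 2) ℝ) = x.1.2.2.2.1)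
    (h₂ : Q₂ * (Matrix.fromRows 1 0 : Matrix (Fin 2 ⊕ Fin n) (Fin 2) ℝ) = x.2.1.2.2.2.1) :
    LinearMap.range (schurFrame Q₁ hQ₁ Q₂ hQ₂) = schurTangent x := by
  have r₁ := range_layerFrame hQ₁ x.1 h₁
  have r₂ := range_layerFrame hQ₂ x.2.1 h₂
  rw [schurFrame, LinearMap.range_comp, LinearMap.range_comp_of_range_eq_top _
    (LinearEquiv.range _), r₁]
  rw [← LinearMap.range_comp_of_range_eq_top _ (LinearEquiv.range (orthogonalConj Q₂ hQ₂).symm)]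
    at r₂
  ext y
  change _ ↔ y.1 ∈ layerTangent x.1 ∧ y.2 ∈ (layerTangent x.2.1).prod ⊤
  rw [← r₂]
  constructor
  · rintro ⟨w, ⟨hw, -⟩, rfl⟩
    exact ⟨hw, LinearMap.mem_range_self _ _⟩
  · rintro ⟨h, Y, hY⟩
    exact ⟨(y.1, Y), ⟨h, trivial⟩, Prod.ext rfl hY⟩

theorem hasFDerivWithinAt_schurMap {n : ℕ}
    {U₁ : Set (Matrix (Fin 2 ⊕ (Fin 2 ⊕ Fin n)) (Fin 2) ℝ)} (hU₁ : IsOpen U₁)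
    {U₂ : Set (Matrix (Fin 2 ⊕ Fin n) (Fin 2) ℝ)} (hU₂ : IsOpen U₂)
    {R₁ : Matrix (Fin 2 ⊕ (Fin 2 ⊕ Fin n)) (Fin 2) ℝ →
      Matrix (Fin 2 ⊕ (Fin 2 ⊕ Fin n)) (Fin 2 ⊕ (Fin 2 ⊕ Fin n)) ℝ}
    {R₂ : Matrix (Fin 2 ⊕ Fin n) (Fin 2) ℝ → Matrix (Fin 2 ⊕ Fin n) (Fin 2 ⊕ Fin n) ℝ}
    (hR₁ : IsFrameCompletion U₁ R₁) (hR₂ : IsFrameCompletion U₂ R₂) {x : SchurParam n}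
    (hx : x ∈ schurManifold n) (hv : x.1.2.2.2.1 ∈ U₁) (hu : x.2.1.2.2.2.1 ∈ U₂) :
    HasFDerivWithinAt (schurMap R₁ R₂)
      ((fderivWithin ℝ (schurStepMap R₁) (layerManifold (Fin 2 ⊕ Fin n) ×ˢ Set.univ)
        (x.1, schurStepMap R₂ x.2)).comp ((ContinuousLinearMap.fst ℝ _ _).prod
          ((fderivWithin ℝ (schurStepMap R₂) (layerManifold (Fin n) ×ˢ Set.univ) x.2).comp
            (ContinuousLinearMap.snd ℝ _ _)))) (schurManifold n) x := by
  have h₁ := (differentiableWithinAt_schurStepMap hR₁ hU₁ hx.1 hv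
    (schurStepMap R₂ x.2)).hasFDerivWithinAt
  have h₂ := (differentiableWithinAt_schurStepMap hR₂ hU₂ hx.2.1 hu x.2.2).hasFDerivWithinAt
  have h₃ : HasFDerivWithinAt (fun y : SchurParam n => schurStepMap R₂ y.2)
      ((fderivWithin ℝ (schurStepMap R₂) (layerManifold (Fin n) ×ˢ Set.univ) x.2).comp
        (ContinuousLinearMap.snd ℝ _ _)) (schurManifold n) x :=
    h₂.comp x (f := Prod.snd) hasFDerivWithinAt_snd (fun y hy => hy.2)
  exact h₁.comp x (f := fun y : SchurParam n => (y.1, schurStepMap R₂ y.2))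
    (hasFDerivWithinAt_fst.prodMk h₃) (fun y hy => ⟨hy.1, trivial⟩)

/-- Ω lies in a proper subset of the ambient space cut out by equations, so a derivative within it
need not be unique. Along a tangent vector, however, both values are the velocity of `f` on the same
curve in Ω. -/
theorem HasFDerivWithinAt.apply_eq_on_schurTangent {n : ℕ} {F : Type*} [NormedAddCommGroup F]
    [NormedSpace ℝ F] {f : SchurParam n → F} {f' f'' : SchurParam n →L[ℝ] F} {x : SchurParam n}
    (hx : x ∈ schurManifold n) (h' : HasFDerivWithinAt f f' (schurManifold n) x)
    (h'' : HasFDerivWithinAt f f'' (schurManifold n) x) {ξ : SchurParam n}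
    (hξ : ξ ∈ schurTangent x) : f' ξ = f'' ξ := by
  obtain ⟨γ₁, h₁, d₁, m₁⟩ := exists_curve_layer hx.1 hξ.1
  obtain ⟨γ₂, h₂, d₂, m₂⟩ := exists_curve_layer hx.2.1 hξ.2.1
  have h0 : (γ₁ 0, γ₂ 0, x.2.2 + (0 : ℝ) • ξ.2.2) = x := by simp [h₁, h₂]
  have hd := d₁.prodMk (d₂.prodMk (hasDerivAt_add_smul x.2.2 ξ.2.2))
  have hm : ∀ᶠ t in nhds (0 : ℝ), (γ₁ t, γ₂ t, x.2.2 + t • ξ.2.2) ∈ schurManifold n := by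
    filter_upwards [m₁, m₂] with t k₁ k₂
    exact ⟨k₁, k₂, trivial⟩
  exact (h'.hasDerivAt_comp_curve h0 hd hm).unique (h''.hasDerivAt_comp_curve h0 hd hm)

end

theorem mainTheorem7 (n : ℕ)
    (U₁ : Set (Matrix (Fin 2 ⊕ (Fin 2 ⊕ Fin n)) (Fin 2) ℝ)) (hU₁ : IsOpen U₁)
    (U₂ : Set (Matrix (Fin 2 ⊕ Fin n) (Fin 2) ℝ)) (hU₂ : IsOpen U₂)
    (R₁ : Matrix (Fin 2 ⊕ (Fin 2 ⊕ Fin n)) (Fin 2) ℝ →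
      Matrix (Fin 2 ⊕ (Fin 2 ⊕ Fin n)) (Fin 2 ⊕ (Fin 2 ⊕ Fin n)) ℝ)
    (R₂ : Matrix (Fin 2 ⊕ Fin n) (Fin 2) ℝ → Matrix (Fin 2 ⊕ Fin n) (Fin 2 ⊕ Fin n) ℝ)
    (hR₁ : IsFrameCompletion U₁ R₁) (hR₂ : IsFrameCompletion U₂ R₂)
    (a₁ b₁ θ₁ a₂ b₂ θ₂ : ℝ)
    (v : Matrix (Fin 2 ⊕ (Fin 2 ⊕ Fin n)) (Fin 2) ℝ) (W₁ : Matrix (Fin 2 ⊕ Fin n) (Fin 2) ℝ)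
    (u : Matrix (Fin 2 ⊕ Fin n) (Fin 2) ℝ) (W₂ : Matrix (Fin n) (Fin 2) ℝ)
    (M₂ : Matrix (Fin n) (Fin n) ℝ)
    (hx : ((a₁, b₁, θ₁, v, W₁), (a₂, b₂, θ₂, u, W₂), M₂) ∈ schurManifold n)
    (hv : v ∈ U₁) (hu : u ∈ U₂)
    (z₁ z₂ : ℂ) (hz₁ : z₁ = a₁ + b₁ * Complex.I) (hz₂ : z₂ = a₂ + b₂ * Complex.I) :
    DifferentiableWithinAt ℝ (schurMap R₁ R₂) (schurManifold n)
        ((a₁, b₁, θ₁, v, W₁), (a₂, b₂, θ₂, u, W₂), M₂) ∧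
    schurJacobian R₁ R₂ ((a₁, b₁, θ₁, v, W₁), (a₂, b₂, θ₂, u, W₂), M₂) =
      256 * b₁ ^ 2 * b₂ ^ 2 * |Real.cos (2 * θ₁)| * |Real.cos (2 * θ₂)| /
          (Real.sin (2 * θ₁) ^ 2 * Real.sin (2 * θ₂) ^ 2) *
        ‖z₁ - z₂‖ ^ 2 * ‖z₁ - starRingEnd ℂ z₂‖ ^ 2 *
        ‖(M₂.map (fun x : ℝ => (x : ℂ)) - z₁ • (1 : Matrix (Fin n) (Fin n) ℂ)).det‖ ^ 2 *
        ‖(M₂.map (fun x : ℝ => (x : ℂ)) - z₂ • (1 : Matrix (Fin n) (Fin n) ℂ)).det‖ ^ 2 := by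
  set p₁ : Layer (Fin 2 ⊕ Fin n) := (a₁, b₁, θ₁, v, W₁) with hp₁
  set p₂ : Layer (Fin n) := (a₂, b₂, θ₂, u, W₂) with hp₂
  have hD := hasFDerivWithinAt_schurMap hU₁ hU₂ hR₁ hR₂ hx hv hu
  refine ⟨hD.differentiableWithinAt, ?_⟩
  have hQ₁ := hR₁.transpose_mul_self hx.1.2.2 hv
  have hQ₂ := hR₂.transpose_mul_self hx.2.1.2.2 hu
  have hc₁ := hR₁.mul_fromRows hx.1.2.2 hv
  have hc₂ := hR₂.mul_fromRows hx.2.1.2.2 hu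
  have hrange := range_schurFrame (p₁, p₂, M₂) hQ₁ hQ₂ hc₁ hc₂
  let N : Matrix (Fin 2 ⊕ Fin n) (Fin 2 ⊕ Fin n) ℝ →ₗ[ℝ] Matrix (Fin 2 ⊕ Fin n) (Fin 2 ⊕ Fin n) ℝ :=
    (fderivWithin ℝ (schurStepMap R₂) (layerManifold (Fin n) ×ˢ Set.univ) (p₂, M₂)).toLinearMap ∘ₗ
      layerFrame (R₂ u) ∘ₗ (orthogonalConj (R₂ u) hQ₂).symm.toLinearMap
  -- Inner step: dM⁽²⁾ is a free parameter, so its slot carries the identity.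
  have hN := abs_det_schurStep hR₂ hU₂ hx.2.1 hu M₂ LinearMap.id hQ₂ N (fun Y => rfl)
  -- Outer step, with `N` in the 22 slot. The chain rule derivative may replace `fderivWithin`
  -- because the frame takes values in the tangent space.
  rw [schurJacobian, jacobianFactor_eq_abs_det _ _ _ _ (Matrix.stdBasis ℝ _ _)
    frobeniusForm_stdBasis _ hrange (schurMetric_schurFrame (p₁, p₂, M₂) hQ₁ hQ₂ hc₁ hc₂),
    abs_det_schurStep hR₁ hU₁ hx.1 hv (schurStepMap R₂ (p₂, M₂)) N hQ₁ _ (fun Y =>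
      HasFDerivWithinAt.apply_eq_on_schurTangent hx hD.differentiableWithinAt.hasFDerivWithinAt hD
        (hrange ▸ LinearMap.mem_range_self _ Y)), hN]
  have ht : 0 < Real.tan θ₂ := tan_pos_of_mem hx.2.1.2.1
  -- Splits det(M⁽¹⁾ - λ₁) into the interaction of the two eigenvalue pairs and det(M⁽²⁾ - λ₁).
  have hM := norm_det_schurLambda_block hQ₂ a₂ b₂ (b₂ * Real.tan θ₂) (b₂ / Real.tan θ₂)
    (by field_simp) W₂ᵀ M₂ z₁
  have hM' : schurStepMap R₂ (p₂, M₂) = R₂ u * Matrix.fromBlocks !![a₂, b₂ * Real.tan θ₂;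
    -(b₂ / Real.tan θ₂), a₂] W₂ᵀ 0 M₂ * (R₂ u)ᵀ := rfl
  rw [← hM', ← hz₂] at hM
  simp only [hp₁, hp₂, LinearMap.det_id, abs_one, mul_one]
  simp only [hp₂] at hM
  rw [← hz₁, ← hz₂, hM]
  ring
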